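/- A cyclic pre-Hilbert space is a real inner product space $(V,(\cdot,\cdot))$ with a vector $1\in V$, $(1,1)=1$, and a positive semidefinite hermitian sesquilinear form $\ll\cdot,\cdot\gg$ on $(V\otimes V)\otimes\mathbb C$ (linear in the first variable) such that for all $v,a,b,c,d\in V$ $$(v,v)=\ll v\otimes1,v\otimes1\gg=\ll1\otimes v,1\otimes v\gg,\quad \ll a\otimes b,c\otimes d\gg=\ll c\otimes a,d\otimes b\gg=\overline{\ll b\otimes a,d\otimes c\gg}.$$ Two elements $s,t$ of $(V\otimes V)\otimes\mathbb C$ are identified when $\ll s-t,s-t\gg=0$; we write $s\equiv t$. Let $J_V$ be the conjugate-linear map on $(V\otimes V)\otimes\mathbb C$ with $J_V(a\otimes b)=b\otimes a$. Let $V$ be a finite-dimensional cyclic pre-Hilbert space with orthonormal basis $x_1,\dots,x_n$, and let $y\in(V\otimes V)\otimes\mathbb C$ satisfy $J_Vy=y$, $\ll y,y\gg=1$, $y\not\equiv v\otimes 1$ and $y\not\equiv 1\otimes v$ for all $v\in V$, and $\ll y,v\otimes1\gg=\ll y,1\otimes v\gg$ for all $v\in V$ (the last condition is automatic if $v\otimes1\equiv1\otimes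 v$ for all $v\in V$, as happens for real subspaces of the self-adjoint part of a tracial von Neumann algebra with $\ll a\otimes b,c\otimes d\gg=\tau(abdc)$). Then for every $\varepsilon>0$ there is an $\varepsilon$-perturbation of $\ll\cdot,\cdot\gg$, that is, a positive semidefinite hermitian form $\ll\cdot,\cdot\gg_\varepsilon$ on $(V\otimes V)\otimes\mathbb C$ with $$|\ll x_i\otimes x_j,x_k\otimes x_l\gg-\ll x_i\otimes x_j,x_k\otimes x_l\gg_\varepsilon|<\varepsilon\qquad\text{for all } i,j,k,l,$$ and a cyclic pre-Hilbert space structure on $W=V\oplus\mathbb RY$ with the same distinguished vector $1$, whose inner product extends that of $V$ and whose form extends $\ll\cdot,\cdot\gg_\varepsilon$, such that $y\equiv1\otimes Y\equiv Y\otimes1$ with respect to the form of $W$. -/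

import Mathlib

open scoped TensorProduct ComplexConjugate

noncomputable section

namespace CyclicSpace

/-- The complexified tensor square `(V ⊗ V) ⊗ ℂ` of a real vector space `V`
(the factor `ℂ` is written on the left, where Mathlib puts the complex structure). -/
abbrev TensorSq (V : Type*) [AddCommGroup V] [Module ℝ V] : Type _ :=
  ℂ ⊗[ℝ] (V ⊗[ℝ] V)

section

variable {V W : Type*} [AddCommGroup V] [Module ℝ V] [AddCommGroup W] [Module ℝ W]

/-- The elementary tensor `a ⊗ b`, as an element of `(V ⊗ V) ⊗ ℂ`. -/
def tmul (a b : V) : TensorSq V := (1 : ℂ) ⊗ₜ[ℝ] (a ⊗ₜ[ℝ] b)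

/-- The conjugate-linear flip: `J (z • (a ⊗ b)) = conj z • (b ⊗ a)`. -/
def J : TensorSq V →ₗ[ℝ] TensorSq V :=
  TensorProduct.map Complex.conjAe.toLinearMap (TensorProduct.comm ℝ V V).toLinearMap

/-- The map `(V ⊗ V) ⊗ ℂ → (W ⊗ W) ⊗ ℂ` induced by a linear map `V → W`. -/
def mapSq (f : V →ₗ[ℝ] W) : TensorSq V →ₗ[ℂ] TensorSq W :=
  (TensorProduct.map f f).baseChange ℂ

theorem J_smul_tmul (z : ℂ) (a b : V) : J (z • tmul a b) = conj z • tmul b a := by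
  simp [J, tmul, TensorProduct.smul_tmul']

theorem mapSq_tmul (f : V →ₗ[ℝ] W) (a b : V) : mapSq f (tmul a b) = tmul (f a) (f b) := by
  simp [mapSq, tmul]

end

/-- Sesquilinear forms on `(V ⊗ V) ⊗ ℂ`, linear in the first variable and conjugate-linear in
the second. -/
abbrev SesqForm (V : Type*) [AddCommGroup V] [Module ℝ V] : Type _ :=
  TensorSq V →ₗ[ℂ] TensorSq V →ₗ⋆[ℂ] ℂ

/-- Hermitian and positive (semidefinite). -/
structure IsHermitianPositive {V : Type*} [AddCommGroup V] [Module ℝ V] (B : SesqForm V) :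
    Prop where
  hermitian : ∀ s t, B s t = conj (B t s)
  nonneg : ∀ s, 0 ≤ (B s s).re

/-- The data `((·,·), 1, ≪·,·≫)` making a real vector space `V` a cyclic pre-Hilbert space. -/
structure CyclicStructure (V : Type*) [AddCommGroup V] [Module ℝ V] where
  /-- the real inner product `(·,·)` -/
  ip : V →ₗ[ℝ] V →ₗ[ℝ] ℝ
  ip_symm : ∀ v w, ip v w = ip w v
  ip_pos : ∀ v, v ≠ 0 → 0 < ip v v
  /-- the distinguished vector `1` -/
  one : V
  ip_one_one : ip one one = 1
  /-- the form `≪·,·≫` -/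
  form : SesqForm V
  form_hermitianPositive : IsHermitianPositive form
  isometric_right : ∀ v, form (tmul v one) (tmul v one) = (ip v v : ℂ)
  isometric_left : ∀ v, form (tmul one v) (tmul one v) = (ip v v : ℂ)
  cyclic : ∀ a b c d, form (tmul a b) (tmul c d) = form (tmul c a) (tmul d b)
  selfAdjoint : ∀ a b c d, form (tmul a b) (tmul c d) = conj (form (tmul b a) (tmul d c))

namespace CyclicStructure

variable {V : Type*} [AddCommGroup V] [Module ℝ V]

/-- Equality of elements of `(V ⊗ V) ⊗ ℂ` as seen by the form: `≪s - t, s - t≫ = 0`. -/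
def Same (S : CyclicStructure V) (s t : TensorSq V) : Prop :=
  S.form (s - t) (s - t) = 0

/-- `y` is neither an element of `V ⊗ 1` nor of `1 ⊗ V`. -/
def NonTrivial (S : CyclicStructure V) (y : TensorSq V) : Prop :=
  (∀ v : V, ¬ S.Same y (tmul v S.one)) ∧ (∀ v : V, ¬ S.Same y (tmul S.one v))

/-- The family `x` is orthonormal for the inner product of `S`. -/
def IsOrthonormal (S : CyclicStructure V) {ι : Type*} (x : ι → V) : Prop :=
  (∀ i, S.ip (x i) (x i) = 1) ∧ ∀ i j, i ≠ j → S.ip (x i) (x j) = 0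

/-- `B` is an `ε`-perturbation of the form of `S`, with respect to the basis `x`. -/
def IsPerturbation (S : CyclicStructure V) {ι : Type*} (x : ι → V) (ε : ℝ) (B : SesqForm V) :
    Prop :=
  IsHermitianPositive B ∧
    ∀ i j k l, ‖S.form (tmul (x i) (x j)) (tmul (x k) (x l)) -
      B (tmul (x i) (x j)) (tmul (x k) (x l))‖ < ε

/-- The cyclic structure `U` on `W = V ⊕ ℝY` (realised as `V × ℝ`, with `Y = (0, 1)`) has the
distinguished vector of `S`, its inner product extends that of `S`, and its form extends `B`. -/
def IsExtension (S : CyclicStructure V) (B : SesqForm V) (U : CyclicStructure (V × ℝ)) : Prop :=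
  U.one = (S.one, 0) ∧
    (∀ v w : V, U.ip (v, 0) (w, 0) = S.ip v w) ∧
    ∀ s t, U.form (mapSq (LinearMap.inl ℝ V ℝ) s) (mapSq (LinearMap.inl ℝ V ℝ) t) = B s t

end CyclicStructure

end CyclicSpace

end

/-! Read `≪a⊗b, c⊗d≫` as a trace `τ(abdc)`: the symmetries say that words of length four may be
rotated, and that reversing one conjugates it. Adjoining `Y` means choosing the words that contain
`Y`: `F(c,a,b) = τ(Ycab)`, `g = τ(YY··)`, `k = τ(Y·Y·)`, `m = τ(YYY·)` and `D = τ(YYYY)`. The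
relations `y ≡ 1⊗Y ≡ Y⊗1` fix these only when a letter is `1`; on the complement of `1` one takes `k
= 0`, `m = 0`, and `g`, `D` so large that they dominate the cross terms with `V ⊗ V`
(`IsWordForm.nonneg`).

There are two obstacles. First, domination requires the functionals `F(c,·,·)` and `g` on `(V ⊗ V) ⊗
ℂ` to vanish on null vectors. This is the reason for the perturbation: mixing in a small multiple of
a free form (`exists_free`) leaves at most the multiples of one vector `e⊗1 - 1⊗e` as null vectors.
The direction `e` cannot always be avoided, because the free form must also satisfy `≪y, v⊗1≫ = ≪y,
1⊗v≫`, which involves the imaginary part of the component of `y` in `V ⊗ 1`. If `e⊗1 - 1⊗e` was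
already null, `y` is changed by a null vector to remove that imaginary part; otherwise the mixture
is definite (`exists_isGeneric`).

Second, contracting `F(c,·,·)` with `y` must give `τ(YcY1) = τ(Y1Yc)`, which the symmetries force to
be real. By duality, a cubic form `F` can be corrected to achieve this unless some vector `o`
obstructs. An obstruction forces `y` into the shape `α 1⊗1 + p⊗1 + 1⊗p + l o⊗o` with `p`, `o`, `e`
linearly related, and then the symmetries alone make the contraction at `o` real
(`exists_real_isCubic`). -/

noncomputable section

namespace CyclicSpace

/-! ### The complexified tensor square: functionals and sesquilinear forms -/

section Basic

variable {V : Type*} [AddCommGroup V] [Module ℝ V]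

theorem tmul_add_left (a a' b : V) : tmul (a + a') b = tmul a b + tmul a' b := by
  simp [tmul, TensorProduct.add_tmul, TensorProduct.tmul_add]

theorem tmul_add_right (a b b' : V) : tmul a (b + b') = tmul a b + tmul a b' := by
  simp [tmul, TensorProduct.tmul_add]

theorem tmul_smul_left (r : ℝ) (a b : V) : tmul (r • a) b = (r : ℂ) • tmul a b := by
  rw [tmul, ← TensorProduct.smul_tmul', TensorProduct.tmul_smul, tmul, TensorProduct.smul_tmul',
    TensorProduct.smul_tmul', Complex.real_smul, smul_eq_mul]

theorem tmul_smul_right (r : ℝ) (a b : V) : tmul a (r • b) = (r : ℂ) • tmul a b := by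
  rw [← tmul_smul_left, tmul, tmul, TensorProduct.smul_tmul]

theorem tmul_sub_left (a a' b : V) : tmul (a - a') b = tmul a b - tmul a' b := by
  rw [eq_sub_iff_add_eq, ← tmul_add_left, sub_add_cancel]

theorem tmul_sub_right (a b b' : V) : tmul a (b - b') = tmul a b - tmul a b' := by
  rw [eq_sub_iff_add_eq, ← tmul_add_right, sub_add_cancel]

@[simp] theorem tmul_zero_left (b : V) : tmul (0 : V) b = 0 := by simp [tmul]

@[simp] theorem tmul_zero_right (a : V) : tmul a (0 : V) = 0 := by simp [tmul]

theorem tensorSq_induction {p : TensorSq V → Prop} (s : TensorSq V)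
    (smul_tmul : ∀ (z : ℂ) (a b : V), p (z • tmul a b))
    (add : ∀ s t, p s → p t → p (s + t)) : p s := by
  have h0 : p 0 := by simpa using smul_tmul 0 0 0
  induction s using TensorProduct.induction_on with
  | zero => exact h0
  | add s t hs ht => exact add s t hs ht
  | tmul z u =>
    induction u using TensorProduct.induction_on with
    | zero => simpa using h0
    | add s t hs ht => rw [TensorProduct.tmul_add]; exact add _ _ hs ht
    | tmul a b =>
      have := smul_tmul z a b
      rwa [tmul, TensorProduct.smul_tmul', smul_eq_mul, mul_one] at this

theorem linearMap_ext {M : Type*} [AddCommGroup M] [Module ℂ M] {σ : ℂ →+* ℂ}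
    {f g : TensorSq V →ₛₗ[σ] M} (h : ∀ a b, f (tmul a b) = g (tmul a b)) : f = g := by
  ext s
  induction s using tensorSq_induction with
  | smul_tmul z a b => rw [map_smulₛₗ, map_smulₛₗ, h]
  | add s t hs ht => rw [map_add, map_add, hs, ht]

theorem sesqForm_ext {B B' : SesqForm V}
    (h : ∀ a b c d, B (tmul a b) (tmul c d) = B' (tmul a b) (tmul c d)) : B = B' :=
  linearMap_ext fun a b => linearMap_ext fun c d => h a b c d

/-- The linear functional on `(V ⊗ V) ⊗ ℂ` induced by a bilinear map. -/
def contr (β : V →ₗ[ℝ] V →ₗ[ℝ] ℂ) : TensorSq V →ₗ[ℂ] ℂ :=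
  (TensorProduct.lift β).liftBaseChange ℂ

@[simp] theorem contr_tmul (β : V →ₗ[ℝ] V →ₗ[ℝ] ℂ) (a b : V) : contr β (tmul a b) = β a b := by
  simp [contr, tmul]

theorem contr_add (β γ : V →ₗ[ℝ] V →ₗ[ℝ] ℂ) : contr (β + γ) = contr β + contr γ :=
  linearMap_ext fun a b => by simp

theorem contr_smul (r : ℝ) (β : V →ₗ[ℝ] V →ₗ[ℝ] ℂ) : contr (r • β) = (r : ℂ) • contr β :=
  linearMap_ext fun a b => by simp

@[simp] theorem contr_zero : contr (0 : V →ₗ[ℝ] V →ₗ[ℝ] ℂ) = 0 :=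
  linearMap_ext fun a b => by simp

theorem contr_sub (β γ : V →ₗ[ℝ] V →ₗ[ℝ] ℂ) : contr (β - γ) = contr β - contr γ :=
  linearMap_ext fun a b => by simp

theorem contr_J {β γ : V →ₗ[ℝ] V →ₗ[ℝ] ℂ} (h : ∀ a b, γ a b = conj (β b a)) (s : TensorSq V) :
    contr γ (J s) = conj (contr β s) := by
  induction s using tensorSq_induction with
  | smul_tmul z a b => rw [J_smul_tmul]; simp [h]
  | add s t hs ht => simp only [map_add, hs, ht]

/-- The product of two real functionals, as a complex valued bilinear map. -/
def prodForm (η ζ : V →ₗ[ℝ] ℝ) : V →ₗ[ℝ] V →ₗ[ℝ] ℂ :=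
  LinearMap.mk₂ ℝ (fun a b => ((η a * ζ b : ℝ) : ℂ))
    (by intros; simp; ring) (by intros; simp; ring) (by intros; simp; ring) (by intros; simp; ring)

@[simp] theorem prodForm_apply (η ζ : V →ₗ[ℝ] ℝ) (a b : V) :
    prodForm η ζ a b = (η a : ℂ) * ζ b := by
  simp [prodForm]

/-- Evaluation of an element of `(V ⊗ V) ⊗ ℂ` on a pair of real functionals. -/
def ev (η ζ : V →ₗ[ℝ] ℝ) : TensorSq V →ₗ[ℂ] ℂ := contr (prodForm η ζ)

@[simp] theorem ev_tmul (η ζ : V →ₗ[ℝ] ℝ) (a b : V) : ev η ζ (tmul a b) = (η a : ℂ) * ζ b := by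
  simp [ev]

theorem ev_add_left (η η' ζ : V →ₗ[ℝ] ℝ) (s : TensorSq V) :
    ev (η + η') ζ s = ev η ζ s + ev η' ζ s := by
  rw [← LinearMap.add_apply]; congr 1
  exact linearMap_ext fun a b => by simp; ring

theorem ev_add_right (η ζ ζ' : V →ₗ[ℝ] ℝ) (s : TensorSq V) :
    ev η (ζ + ζ') s = ev η ζ s + ev η ζ' s := by
  rw [← LinearMap.add_apply]; congr 1
  exact linearMap_ext fun a b => by simp; ring

theorem ev_smul_left (r : ℝ) (η ζ : V →ₗ[ℝ] ℝ) (s : TensorSq V) :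
    ev (r • η) ζ s = r * ev η ζ s := by
  rw [← smul_eq_mul, ← LinearMap.smul_apply]; congr 1
  exact linearMap_ext fun a b => by simp; ring

theorem ev_smul_right (r : ℝ) (η ζ : V →ₗ[ℝ] ℝ) (s : TensorSq V) :
    ev η (r • ζ) s = r * ev η ζ s := by
  rw [← smul_eq_mul, ← LinearMap.smul_apply]; congr 1
  exact linearMap_ext fun a b => by simp; ring

theorem ev_J (η ζ : V →ₗ[ℝ] ℝ) (s : TensorSq V) : ev ζ η (J s) = conj (ev η ζ s) :=
  contr_J (fun a b => by simp [mul_comm]) s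

theorem eq_sum_ev {ι : Type*} [Fintype ι] (x : Module.Basis ι ℝ V) (s : TensorSq V) :
    s = ∑ i, ∑ j, ev (x.coord i) (x.coord j) s • tmul (x i) (x j) := by
  let g : TensorSq V →ₗ[ℂ] TensorSq V :=
    ∑ i, ∑ j, (ev (x.coord i) (x.coord j)).smulRight (tmul (x i) (x j))
  have hg : LinearMap.id = g := by
    refine linearMap_ext fun a b => ?_
    have hl : ∀ b, tmul a b = ∑ i, (x.coord i a : ℂ) • tmul (x i) b := by
      intro b
      let L : V →ₗ[ℝ] TensorSq V :=
        { toFun := fun a => tmul a b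
          map_add' := fun a a' => tmul_add_left a a' b
          map_smul' := fun r a => by rw [tmul_smul_left]; rfl }
      have : L a = L (∑ i, x.coord i a • x i) := by simp [x.sum_repr]
      rw [map_sum] at this
      simpa only [L, LinearMap.coe_mk, AddHom.coe_mk, tmul_smul_left] using this
    have hr : ∀ i, tmul (x i) b = ∑ j, (x.coord j b : ℂ) • tmul (x i) (x j) := by
      intro i
      let L : V →ₗ[ℝ] TensorSq V :=
        { toFun := fun b => tmul (x i) b
          map_add' := fun a a' => tmul_add_right _ a a'
          map_smul' := fun r a => by rw [tmul_smul_right]; rfl }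
      have : L b = L (∑ i, x.coord i b • x i) := by simp [x.sum_repr]
      rw [map_sum] at this
      simpa only [L, LinearMap.coe_mk, AddHom.coe_mk, tmul_smul_right] using this
    simp only [g, LinearMap.sum_apply, LinearMap.smulRight_apply, ev_tmul, LinearMap.id_apply]
    rw [hl]
    refine Finset.sum_congr rfl fun i _ => ?_
    rw [hr, Finset.smul_sum]
    simp only [smul_smul]
  have := LinearMap.congr_fun hg s
  simpa [g] using this

theorem ev_ext [FiniteDimensional ℝ V] {s t : TensorSq V} (h : ∀ η ζ, ev η ζ s = ev η ζ t) :
    s = t := by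
  rw [eq_sum_ev (Module.finBasis ℝ V) s, eq_sum_ev (Module.finBasis ℝ V) t]
  simp only [h]

/-- A quadrilinear map extends to a sesquilinear form on `(V ⊗ V) ⊗ ℂ`. -/
theorem exists_sesqForm (f : V → V → V → V → ℂ)
    (add₁ : ∀ a a' b c d, f (a + a') b c d = f a b c d + f a' b c d)
    (smul₁ : ∀ (r : ℝ) a b c d, f (r • a) b c d = r * f a b c d)
    (add₂ : ∀ a b b' c d, f a (b + b') c d = f a b c d + f a b' c d)
    (smul₂ : ∀ (r : ℝ) a b c d, f a (r • b) c d = r * f a b c d)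
    (add₃ : ∀ a b c c' d, f a b (c + c') d = f a b c d + f a b c' d)
    (smul₃ : ∀ (r : ℝ) a b c d, f a b (r • c) d = r * f a b c d)
    (add₄ : ∀ a b c d d', f a b c (d + d') = f a b c d + f a b c d')
    (smul₄ : ∀ (r : ℝ) a b c d, f a b c (r • d) = r * f a b c d) :
    ∃ B : SesqForm V, ∀ a b c d, B (tmul a b) (tmul c d) = f a b c d := by
  let β : V → V → V →ₗ[ℝ] V →ₗ[ℝ] ℂ := fun c d =>
    LinearMap.mk₂ ℝ (fun a b => f a b c d) (fun _ _ _ => add₁ _ _ _ _ _)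
      (fun _ _ _ => by rw [smul₁]; simp) (fun _ _ _ => add₂ _ _ _ _ _)
      (fun _ _ _ => by rw [smul₂]; simp)
  have hβ : ∀ c d a b, contr (β c d) (tmul a b) = f a b c d := fun c d a b => by simp [β]
  -- `contr` only produces linear functionals, so the values are conjugated here and conjugated back
  -- at the end to obtain conjugate-linearity in the second variable.
  let γ : TensorSq V → V →ₗ[ℝ] V →ₗ[ℝ] ℂ := fun s =>
    LinearMap.mk₂ ℝ (fun c d => conj (contr (β c d) s))
      (fun c c' d => by
        rw [← map_add, ← LinearMap.add_apply]; congr 2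
        exact linearMap_ext fun a b => by simp only [LinearMap.add_apply, hβ, add₃])
      (fun r c d => by
        rw [← Complex.coe_smul, smul_eq_mul, ← Complex.conj_ofReal r, ← map_mul,
          ← smul_eq_mul, ← LinearMap.smul_apply]
        congr 2
        exact linearMap_ext fun a b => by simp only [LinearMap.smul_apply, hβ, smul₃, smul_eq_mul])
      (fun c d d' => by
        rw [← map_add, ← LinearMap.add_apply]; congr 2
        exact linearMap_ext fun a b => by simp only [LinearMap.add_apply, hβ, add₄])
      (fun r c d => by
        rw [← Complex.coe_smul, smul_eq_mul, ← Complex.conj_ofReal r, ← map_mul,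
          ← smul_eq_mul, ← LinearMap.smul_apply]
        congr 2
        exact linearMap_ext fun a b => by simp only [LinearMap.smul_apply, hβ, smul₄, smul_eq_mul])
  have hγ : ∀ s c d, contr (γ s) (tmul c d) = conj (contr (β c d) s) := fun s c d => by simp [γ]
  refine ⟨LinearMap.mk₂'ₛₗ (RingHom.id ℂ) (starRingEnd ℂ) (fun s t => conj (contr (γ s) t))
    ?_ ?_ ?_ ?_, ?_⟩
  · intro s s' t
    rw [← map_add, ← LinearMap.add_apply]; congr 2
    exact linearMap_ext fun a b => by simp only [LinearMap.add_apply, hγ, map_add]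
  · intro z s t
    rw [RingHom.id_apply, smul_eq_mul, ← Complex.conj_conj z, ← map_mul, Complex.conj_conj,
      ← smul_eq_mul, ← LinearMap.smul_apply]
    congr 2
    exact linearMap_ext fun a b => by
      simp only [LinearMap.smul_apply, hγ, map_smul, smul_eq_mul, map_mul]
  · intro s t t'
    simp
  · intro z s t
    simp
  · intro a b c d
    simp [hγ, hβ]

end Basic

/-! ### Positive semidefinite forms, their null vectors and sums of squares -/

section Positive

variable {V : Type*} [AddCommGroup V] [Module ℝ V] {B : SesqForm V}

theorem IsHermitianPositive.im_self (hB : IsHermitianPositive B) (s : TensorSq V) :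
    (B s s).im = 0 :=
  Complex.conj_eq_iff_im.1 (hB.hermitian s s).symm

theorem IsHermitianPositive.self_eq (hB : IsHermitianPositive B) (s : TensorSq V) :
    B s s = ((B s s).re : ℂ) := by
  apply Complex.ext <;> simp [hB.im_self]

theorem IsHermitianPositive.cauchy_schwarz (hB : IsHermitianPositive B) (s t : TensorSq V) :
    ‖B s t‖ ^ 2 ≤ (B s s).re * (B t t).re := by
  have key : ∀ r : ℝ, 0 ≤ (B s s).re * (r * r) + (2 * ‖B s t‖) * r + (B t t).re := by
    intro r
    -- A phase `u` makes the cross term real, so positivity along `r u s + t` is a real quadratic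
    -- inequality in `r` and its discriminant gives the claim.
    obtain ⟨u, hu, hu'⟩ : ∃ u : ℂ, ‖u‖ = 1 ∧ u * B s t = ‖B s t‖ := by
      by_cases h : B s t = 0
      · exact ⟨1, by simp, by simp [h]⟩
      · have hn : (‖B s t‖ : ℂ) ≠ 0 := by simpa using h
        refine ⟨conj (B s t) / ‖B s t‖, by simp [h], ?_⟩
        rw [div_mul_eq_mul_div, mul_comm, Complex.mul_conj, Complex.normSq_eq_norm_sq]
        push_cast
        field_simp
    have hu2 : u * conj u = 1 := by
      rw [Complex.mul_conj, Complex.normSq_eq_norm_sq, hu]; simp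
    have h := hB.nonneg ((r * u : ℂ) • s + t)
    have e : B ((r * u : ℂ) • s + t) ((r * u : ℂ) • s + t)
        = B s s * (r * r) + 2 * ‖B s t‖ * r + B t t := by
      simp only [map_add, map_smulₛₗ, LinearMap.add_apply, LinearMap.smul_apply, smul_eq_mul,
        RingHom.id_apply, map_mul, Complex.conj_ofReal]
      have h1 : conj u * B t s = ‖B s t‖ := by
        rw [hB.hermitian t s, ← map_mul, hu', Complex.conj_ofReal]
      linear_combination (r * r * B s s) * hu2 + r * hu' + r * h1
    rw [e, hB.self_eq s, hB.self_eq t] at h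
    norm_cast at h
  have := discrim_le_zero key
  rw [discrim] at this
  nlinarith

theorem IsHermitianPositive.apply_eq_zero (hB : IsHermitianPositive B) {s : TensorSq V}
    (hs : B s s = 0) (t : TensorSq V) : B s t = 0 ∧ B t s = 0 := by
  have h : B s t = 0 := by
    have := hB.cauchy_schwarz s t
    rw [hs] at this
    simp only [Complex.zero_re, zero_mul] at this
    simpa using le_antisymm this (by positivity)
  exact ⟨h, by rw [hB.hermitian, h, map_zero]⟩

/-- A functional that vanishes on the isotropic vectors of a form is represented by it. -/
theorem exists_representative [FiniteDimensional ℝ V] (φ : TensorSq V →ₗ[ℂ] ℂ) (hφ : ∀ s, B s s = 0 → φ s = 0) :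
    ∃ u, ∀ s, φ s = B s u := by
  let R : Submodule ℂ (Module.Dual ℂ (TensorSq V)) := LinearMap.range B.flip
  have hR : φ ∈ R := by
    -- In finite dimension a subspace of the dual is the annihilator of its coannihilator. A vector
    -- `s` of the coannihilator satisfies `B s t = 0` for all `t`, in particular for `t = s`.
    rw [← Subspace.dualCoannihilator_dualAnnihilator_eq (W := R), Submodule.mem_dualAnnihilator]
    intro s hs
    rw [Submodule.mem_dualCoannihilator] at hs
    exact hφ s (hs _ ⟨s, rfl⟩)
  obtain ⟨u, hu⟩ := hR
  exact ⟨u, fun s => by rw [← hu]; rfl⟩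

theorem IsHermitianPositive.exists_bound [FiniteDimensional ℝ V]
    (hB : IsHermitianPositive B) (φ : TensorSq V →ₗ[ℂ] ℂ) (hφ : ∀ s, B s s = 0 → φ s = 0) :
    ∃ K : ℝ, 0 ≤ K ∧ ∀ s, ‖φ s‖ ^ 2 ≤ K * (B s s).re := by
  obtain ⟨u, hu⟩ := exists_representative φ hφ
  refine ⟨(B u u).re, hB.nonneg u, fun s => ?_⟩
  rw [hu, mul_comm]
  exact hB.cauchy_schwarz s u

end Positive

section RankOne

variable {V : Type*} [AddCommGroup V] [Module ℝ V]

/-- The form `(s, t) ↦ φ s * conj (φ t)`. -/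
def rankOne (φ : TensorSq V →ₗ[ℂ] ℂ) : SesqForm V :=
  LinearMap.mk₂'ₛₗ (RingHom.id ℂ) (starRingEnd ℂ) (fun s t => φ s * conj (φ t))
    (by intros; simp; ring) (by intros; simp; ring) (by intros; simp; ring) (by intros; simp; ring)

@[simp] theorem rankOne_apply (φ : TensorSq V →ₗ[ℂ] ℂ) (s t : TensorSq V) :
    rankOne φ s t = φ s * conj (φ t) := rfl

theorem isHermitianPositive_rankOne (φ : TensorSq V →ₗ[ℂ] ℂ) :
    IsHermitianPositive (rankOne φ) where
  hermitian s t := by simp [mul_comm]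
  nonneg s := by
    rw [rankOne_apply, Complex.mul_conj, Complex.ofReal_re]
    exact Complex.normSq_nonneg _

theorem IsHermitianPositive.add {B B' : SesqForm V} (hB : IsHermitianPositive B)
    (hB' : IsHermitianPositive B') : IsHermitianPositive (B + B') where
  hermitian s t := by
    rw [LinearMap.add_apply, LinearMap.add_apply, LinearMap.add_apply, LinearMap.add_apply,
      map_add, ← hB.hermitian, ← hB'.hermitian]
  nonneg s := by
    rw [LinearMap.add_apply, LinearMap.add_apply, Complex.add_re]
    exact add_nonneg (hB.nonneg s) (hB'.nonneg s)

theorem IsHermitianPositive.smul {B : SesqForm V} (hB : IsHermitianPositive B) {r : ℝ}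
    (hr : 0 ≤ r) : IsHermitianPositive ((r : ℂ) • B) where
  hermitian s t := by
    rw [LinearMap.smul_apply, LinearMap.smul_apply, LinearMap.smul_apply, LinearMap.smul_apply,
      smul_eq_mul, smul_eq_mul, map_mul, ← hB.hermitian, Complex.conj_ofReal]
  nonneg s := by
    rw [LinearMap.smul_apply, LinearMap.smul_apply, smul_eq_mul, Complex.re_ofReal_mul]
    exact mul_nonneg hr (hB.nonneg s)

theorem IsHermitianPositive.sum {ι : Type*} (I : Finset ι) {B : ι → SesqForm V}
    (hB : ∀ i, IsHermitianPositive (B i)) : IsHermitianPositive (∑ i ∈ I, B i) := by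
  classical
  induction I using Finset.induction_on with
  | empty => exact ⟨fun s t => by simp, fun s => by simp⟩
  | insert i I hi h => rw [Finset.sum_insert hi]; exact (hB i).add h

theorem IsHermitianPositive.of_add_eq_zero {B B' : SesqForm V} (hB : IsHermitianPositive B)
    (hB' : IsHermitianPositive B') {s : TensorSq V} (h : (B + B') s s = 0) :
    B s s = 0 ∧ B' s s = 0 := by
  rw [LinearMap.add_apply, LinearMap.add_apply, hB.self_eq, hB'.self_eq] at h
  norm_cast at h
  have h1 := hB.nonneg s
  have h2 := hB'.nonneg s
  rw [hB.self_eq, hB'.self_eq]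
  norm_cast
  constructor <;> linarith

theorem IsHermitianPositive.of_sum_eq_zero {ι : Type*} [Fintype ι] {B : ι → SesqForm V}
    (hB : ∀ i, IsHermitianPositive (B i)) {s : TensorSq V} (h : (∑ i, B i) s s = 0) (i : ι) :
    B i s s = 0 := by
  classical
  rw [← Finset.add_sum_erase _ _ (Finset.mem_univ i)] at h
  exact ((hB i).of_add_eq_zero (.sum _ hB) h).1

theorem rankOne_eq_zero {φ : TensorSq V →ₗ[ℂ] ℂ} {s : TensorSq V} (h : rankOne φ s s = 0) :
    φ s = 0 := by
  simpa using h

theorem ev_sum_smul_left {ι : Type*} (I : Finset ι) (c : ι → ℝ) (η : ι → V →ₗ[ℝ] ℝ)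
    (ζ : V →ₗ[ℝ] ℝ) (s : TensorSq V) :
    ev (∑ i ∈ I, c i • η i) ζ s = ∑ i ∈ I, c i * ev (η i) ζ s := by
  classical
  induction I using Finset.induction_on with
  | empty => simpa using ev_smul_left 0 0 ζ s
  | insert i I hi h => rw [Finset.sum_insert hi, Finset.sum_insert hi, ev_add_left, h, ev_smul_left]

theorem ev_sum_smul_right {ι : Type*} (I : Finset ι) (c : ι → ℝ) (η : ι → V →ₗ[ℝ] ℝ)
    (ζ : V →ₗ[ℝ] ℝ) (s : TensorSq V) :
    ev ζ (∑ i ∈ I, c i • η i) s = ∑ i ∈ I, c i * ev ζ (η i) s := by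
  classical
  induction I using Finset.induction_on with
  | empty => simpa using ev_smul_right 0 ζ 0 s
  | insert i I hi h =>
    rw [Finset.sum_insert hi, Finset.sum_insert hi, ev_add_right, h, ev_smul_right]

end RankOne

/-! ### The free form -/

namespace CyclicStructure

variable {V : Type*} [AddCommGroup V] [Module ℝ V] (S : CyclicStructure V)

theorem form_conj (a b c d : V) :
    conj (S.form (tmul a b) (tmul c d)) = S.form (tmul c d) (tmul a b) :=
  (S.form_hermitianPositive.hermitian _ _).symm

theorem form_J (s t : TensorSq V) : S.form (J s) (J t) = conj (S.form s t) := by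
  induction s using tensorSq_induction with
  | add s s' hs hs' => simp only [map_add, LinearMap.add_apply, hs, hs']
  | smul_tmul z a b =>
    induction t using tensorSq_induction with
    | add t t' ht ht' => simp only [map_add, ht, ht']
    | smul_tmul w c d =>
      rw [J_smul_tmul, J_smul_tmul]
      simp [S.selfAdjoint b a d c]

section Orthonormal

variable {S} {ι : Type*} [Fintype ι] {x : Module.Basis ι ℝ V}

theorem IsOrthonormal.repr_eq (hx : S.IsOrthonormal x) (v : V) (i : ι) :
    x.repr v i = S.ip (x i) v := by
  conv_rhs => rw [← x.sum_repr v, map_sum]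
  rw [Finset.sum_eq_single i]
  · simp [hx.1]
  · intro j _ hj
    simp [hx.2 i j hj.symm]
  · simp

theorem IsOrthonormal.sum_ip_mul (hx : S.IsOrthonormal x) (η : V →ₗ[ℝ] ℝ) (v : V) :
    ∑ i, η (x i) * S.ip (x i) v = η v := by
  conv_rhs => rw [← x.sum_repr v, map_sum]
  exact Finset.sum_congr rfl fun i _ => by
    rw [map_smul, smul_eq_mul, hx.repr_eq, mul_comm]

theorem IsOrthonormal.sum_ip_mul_ip (hx : S.IsOrthonormal x) (v w : V) :
    ∑ i, S.ip (x i) v * S.ip (x i) w = S.ip v w := by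
  rw [← hx.sum_ip_mul (S.ip v) w]
  exact Finset.sum_congr rfl fun i _ => by rw [S.ip_symm v]

end Orthonormal

/-- The bilinear functional `ip` with complex values. -/
def ipC : V →ₗ[ℝ] V →ₗ[ℝ] ℂ := S.ip.compr₂ Complex.ofRealCLM.toLinearMap

@[simp] theorem ipC_apply (a b : V) : S.ipC a b = S.ip a b := rfl

/-- The difference `e ⊗ 1 - 1 ⊗ e`. -/
def commOne (e : V) : TensorSq V := tmul e S.one - tmul S.one e

/-- A form for which `V` behaves like a free semicircular family, except that `e` is the only
direction in `1ᗮ` that commutes with `1`. -/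
theorem exists_free [FiniteDimensional ℝ V] {ι : Type*} [Fintype ι] (x : Module.Basis ι ℝ V)
    (hx : S.IsOrthonormal x) (e : V) (he1 : S.ip S.one e = 0) (he : e = 0 ∨ S.ip e e = 1) :
    ∃ S' : CyclicStructure V, S'.ip = S.ip ∧ S'.one = S.one ∧
      (∀ s, S'.form s s = 0 → ∃ z : ℂ, s = z • S.commOne e) ∧
      S'.form (S.commOne e) (S.commOne e) = 0 ∧
      ∀ y, J y = y → (∀ ζ : V →ₗ[ℝ] ℝ, ζ e = 0 → (ev ζ (S.ip S.one) y).im = 0) →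
        ∀ w, S'.form y (tmul w S.one) = S'.form y (tmul S.one w) := by
  classical
  set ε := S.ip S.one with hε
  set θ := S.ip e with hθ
  have hθ1 : θ S.one = 0 := by rw [hθ, S.ip_symm]; exact he1
  have hε1 : ε S.one = 1 := S.ip_one_one
  have hθe : ∀ a b, (1 - θ e) * (θ a * θ b) = 0 := by
    intro a b
    rcases he with h | h
    · simp [hθ, h]
    · simp [h]
  have hθee : (1 - θ e) • e = 0 := by
    rcases he with h | h
    · simp [h]
    · simp [h]
  -- The first terms are the two noncrossing pairings of the word `abdc`, with the doubly counted
  -- all-`1` part removed. The last two terms, pairing letters across a `1`, are kept only in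
  -- direction `e`, which is what makes `e` alone commute with `1`.
  obtain ⟨B, hB⟩ := exists_sesqForm (V := V) (fun a b c d =>
    ((S.ip a b * S.ip c d + S.ip a c * S.ip b d - ε a * ε b * ε c * ε d
      + ε a * ε d * θ b * θ c + ε b * ε c * θ a * θ d : ℝ) : ℂ))
    (by intros; push_cast [map_add, LinearMap.add_apply]; ring)
    (by intros; push_cast [map_smul, LinearMap.smul_apply, smul_eq_mul]; ring)
    (by intros; push_cast [map_add, LinearMap.add_apply]; ring)
    (by intros; push_cast [map_smul, LinearMap.smul_apply, smul_eq_mul]; ring)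
    (by intros; push_cast [map_add, LinearMap.add_apply]; ring)
    (by intros; push_cast [map_smul, LinearMap.smul_apply, smul_eq_mul]; ring)
    (by intros; push_cast [map_add, LinearMap.add_apply]; ring)
    (by intros; push_cast [map_smul, LinearMap.smul_apply, smul_eq_mul]; ring)
  -- Coordinates after projecting away `1`, and after projecting away both `1` and `e`; each family
  -- is a Parseval frame for the corresponding complement.
  let X' : ι → V →ₗ[ℝ] ℝ := fun i => S.ip (x i) - ε (x i) • ε
  let X'' : ι → V →ₗ[ℝ] ℝ := fun i => S.ip (x i) - ε (x i) • ε - θ (x i) • θ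
  have hX'η : ∀ (η : V →ₗ[ℝ] ℝ) a, ∑ i, η (x i) * X' i a = η a - η S.one * ε a := by
    intro η a
    have h1 : ∑ i, η (x i) * ε (x i) = η S.one := by
      rw [← hx.sum_ip_mul η S.one]
      exact Finset.sum_congr rfl fun i _ => by rw [hε, S.ip_symm]
    simp only [X', LinearMap.sub_apply, LinearMap.smul_apply, smul_eq_mul, mul_sub,
      Finset.sum_sub_distrib, hx.sum_ip_mul, ← mul_assoc, ← Finset.sum_mul, h1]
  have hX''η : ∀ (η : V →ₗ[ℝ] ℝ) a, ∑ i, η (x i) * X'' i a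
      = η a - η S.one * ε a - η e * θ a := by
    intro η a
    have h1 : ∑ i, η (x i) * θ (x i) = η e := by
      rw [← hx.sum_ip_mul η e]
      exact Finset.sum_congr rfl fun i _ => by rw [hθ, S.ip_symm]
    have h2 := hX'η η a
    simp only [X', X'', LinearMap.sub_apply _ (θ _ • θ), mul_sub _ _ ((θ _ • θ) a),
      Finset.sum_sub_distrib] at h2 ⊢
    rw [h2]
    simp only [LinearMap.smul_apply, smul_eq_mul, ← mul_assoc, ← Finset.sum_mul, h1]
  have hX' : ∀ a c, ∑ i, X' i a * X' i c = S.ip a c - ε a * ε c := by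
    intro a c
    have h1 := hX'η (S.ip a) c
    have h2 := hX'η ε c
    have h3 : ∑ i, X' i a * X' i c
        = ∑ i, S.ip a (x i) * X' i c - ε a * ∑ i, ε (x i) * X' i c := by
      rw [Finset.mul_sum, ← Finset.sum_sub_distrib]
      refine Finset.sum_congr rfl fun i _ => ?_
      simp only [X', LinearMap.sub_apply, LinearMap.smul_apply, smul_eq_mul, S.ip_symm a]
      ring
    rw [h3, h1, h2, hε1, S.ip_symm a S.one]
    ring
  have hX'' : ∀ a c, ∑ i, X'' i a * X'' i c = S.ip a c - ε a * ε c - θ a * θ c := by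
    intro a c
    have h1 := hX''η (S.ip a) c
    have h2 := hX''η ε c
    have h4 := hX''η θ c
    have h3 : ∑ i, X'' i a * X'' i c = ∑ i, S.ip a (x i) * X'' i c
        - ε a * ∑ i, ε (x i) * X'' i c - θ a * ∑ i, θ (x i) * X'' i c := by
      rw [Finset.mul_sum, Finset.mul_sum, ← Finset.sum_sub_distrib, ← Finset.sum_sub_distrib]
      refine Finset.sum_congr rfl fun i _ => ?_
      simp only [X'', LinearMap.sub_apply, LinearMap.smul_apply, smul_eq_mul, S.ip_symm a]
      ring
    rw [h3, h1, h2, h4, hε1, hθ1, S.ip_symm a S.one, S.ip_symm a e, he1]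
    linear_combination -hθe a c
  let B₁ : SesqForm V := rankOne (contr S.ipC)
  let B₂ : ι → ι → SesqForm V := fun i j => rankOne (ev (X' i) (X' j))
  let B₃ : ι → SesqForm V := fun i => rankOne (ev ε (X'' i))
  let B₄ : ι → SesqForm V := fun i => rankOne (ev (X'' i) ε)
  let B₅ : SesqForm V := rankOne (ev ε θ + ev θ ε)
  -- This sum of squares gives positivity, and its individual squares also determine the null
  -- vectors.
  have hsum : B = B₁ + (∑ i, ∑ j, B₂ i j + (∑ i, B₃ i + (∑ i, B₄ i + B₅))) := by
    refine sesqForm_ext fun a b c d => ?_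
    rw [hB]
    have e2 : ∑ i, ∑ j, (X' i a * X' j b) * (X' i c * X' j d)
        = (S.ip a c - ε a * ε c) * (S.ip b d - ε b * ε d) := by
      rw [← hX', ← hX', Finset.sum_mul_sum]
      exact Finset.sum_congr rfl fun i _ => Finset.sum_congr rfl fun j _ => by ring
    have e3 : ∑ i, (ε a * X'' i b) * (ε c * X'' i d)
        = ε a * ε c * (S.ip b d - ε b * ε d - θ b * θ d) := by
      rw [← hX'', Finset.mul_sum]
      exact Finset.sum_congr rfl fun i _ => by ring
    have e4 : ∑ i, (X'' i a * ε b) * (X'' i c * ε d)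
        = ε b * ε d * (S.ip a c - ε a * ε c - θ a * θ c) := by
      rw [← hX'', Finset.mul_sum]
      exact Finset.sum_congr rfl fun i _ => by ring
    simp only [LinearMap.add_apply, LinearMap.sum_apply, B₁, B₂, B₃, B₄, B₅, rankOne_apply,
      contr_tmul, ipC_apply, ev_tmul, map_mul, map_add, Complex.conj_ofReal]
    norm_cast
    rw [e2, e3, e4]
    ring
  have p₁ : IsHermitianPositive B₁ := isHermitianPositive_rankOne _
  have p₂ : ∀ i, IsHermitianPositive (∑ j, B₂ i j) := fun i =>
    .sum _ fun j => isHermitianPositive_rankOne _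
  have p₃ : ∀ i, IsHermitianPositive (B₃ i) := fun i => isHermitianPositive_rankOne _
  have p₄ : ∀ i, IsHermitianPositive (B₄ i) := fun i => isHermitianPositive_rankOne _
  have p₅ : IsHermitianPositive B₅ := isHermitianPositive_rankOne _
  have q₄ := (IsHermitianPositive.sum Finset.univ p₄).add p₅
  have q₃ := (IsHermitianPositive.sum Finset.univ p₃).add q₄
  have q₂ := (IsHermitianPositive.sum Finset.univ p₂).add q₃
  have hpos : IsHermitianPositive B := hsum ▸ p₁.add q₂
  let S' : CyclicStructure V :=
    { ip := S.ip
      ip_symm := S.ip_symm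
      ip_pos := S.ip_pos
      one := S.one
      ip_one_one := S.ip_one_one
      form := B
      form_hermitianPositive := hpos
      isometric_right := fun v => by
        rw [hB, hε1, hθ1, S.ip_symm v S.one]
        congr 1
        simp only [hε]
        ring
      isometric_left := fun v => by
        rw [hB, hε1, hθ1]
        congr 1
        simp only [hε]
        ring
      cyclic := fun a b c d => by
        rw [hB, hB, S.ip_symm c a, S.ip_symm d b]
        congr 1
        ring
      selfAdjoint := fun a b c d => by
        rw [hB, hB, Complex.conj_ofReal, S.ip_symm b a, S.ip_symm d c]
        congr 1
        ring }
  refine ⟨S', rfl, rfl, ?_, ?_, ?_⟩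
  · intro s hs
    change B s s = 0 at hs
    rw [hsum] at hs
    obtain ⟨h₁, hs⟩ := p₁.of_add_eq_zero q₂ hs
    obtain ⟨h₂, hs⟩ := (IsHermitianPositive.sum Finset.univ p₂).of_add_eq_zero q₃ hs
    obtain ⟨h₃, hs⟩ := (IsHermitianPositive.sum Finset.univ p₃).of_add_eq_zero q₄ hs
    obtain ⟨h₄, h₅⟩ := (IsHermitianPositive.sum Finset.univ p₄).of_add_eq_zero p₅ hs
    replace h₁ := rankOne_eq_zero h₁
    replace h₂ : ∀ i j, ev (X' i) (X' j) s = 0 := fun i j =>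
      rankOne_eq_zero (IsHermitianPositive.of_sum_eq_zero
        (fun j => isHermitianPositive_rankOne _) (IsHermitianPositive.of_sum_eq_zero p₂ h₂ i) j)
    replace h₃ : ∀ i, ev ε (X'' i) s = 0 := fun i =>
      rankOne_eq_zero (IsHermitianPositive.of_sum_eq_zero p₃ h₃ i)
    replace h₄ : ∀ i, ev (X'' i) ε s = 0 := fun i =>
      rankOne_eq_zero (IsHermitianPositive.of_sum_eq_zero p₄ h₄ i)
    replace h₅ : ev ε θ s + ev θ ε s = 0 := rankOne_eq_zero h₅
    -- The contraction of `s` with the inner product vanishes, and so does its centred part; only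
    -- the `1⊗1` coefficient remains.
    have hεε : ev ε ε s = 0 := by
      have : contr S.ipC = ev ε ε + ∑ i, ev (X' i) (X' i) := by
        refine linearMap_ext fun a b => ?_
        simp only [LinearMap.add_apply, LinearMap.sum_apply, contr_tmul, ipC_apply, ev_tmul]
        norm_cast
        rw [hX']
        ring
      rw [this, LinearMap.add_apply, LinearMap.sum_apply,
        Finset.sum_eq_zero fun i _ => h₂ i i, add_zero] at h₁
      exact h₁
    have d' : ∀ η : V →ₗ[ℝ] ℝ, η = η S.one • ε + ∑ i, η (x i) • X' i := by
      intro η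
      ext a
      simp [LinearMap.sum_apply, hX'η]
    have d'' : ∀ η : V →ₗ[ℝ] ℝ, ∑ i, η (x i) • X' i = η e • θ + ∑ i, η (x i) • X'' i := by
      intro η
      ext a
      simp [LinearMap.sum_apply, hX'η, hX''η]
    -- Only the coefficients along `e⊗1` and `1⊗e` survive, and `h₅` says that they are opposite.
    refine ⟨ev θ ε s, ev_ext fun η ζ => ?_⟩
    have k₁ : ev (∑ i, η (x i) • X' i) (∑ i, ζ (x i) • X' i) s = 0 := by
      simp [ev_sum_smul_left, ev_sum_smul_right, h₂]
    have k₂ : ev ε (∑ i, ζ (x i) • X' i) s = ζ e * ev ε θ s := by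
      rw [d'', ev_add_right, ev_smul_right]
      simp [ev_sum_smul_right, h₃]
    have k₃ : ev (∑ i, η (x i) • X' i) ε s = η e * ev θ ε s := by
      rw [d'', ev_add_left, ev_smul_left]
      simp [ev_sum_smul_left, h₄]
    have k₄ : ev η ζ s = η S.one * (ζ e * ev ε θ s) + ζ S.one * (η e * ev θ ε s) := by
      rw [d' η, d' ζ, ev_add_left, ev_add_right, ev_add_right, k₁]
      rw [ev_smul_left, ev_smul_left, ev_smul_right, ev_smul_right, hεε, k₂, k₃, ← d' η, ← d' ζ]
      ring
    rw [k₄, map_smul, smul_eq_mul, commOne, map_sub, ev_tmul, ev_tmul]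
    linear_combination (η S.one * ζ e : ℂ) * h₅
  · change B _ _ = 0
    simp only [commOne, map_sub, LinearMap.sub_apply, hB, hε1, hθ1, he1, S.ip_one_one,
      S.ip_symm e S.one]
    push_cast
    rcases he with h | h
    · simp [h, hθ]
    · simp [show S.ip S.one e = 0 from he1, show S.ip e e = 1 from h, h]
  · intro y hJ hy w
    change B y _ = B y _
    let ζ : V →ₗ[ℝ] ℝ := S.ip w - ε w • ε - θ w • θ
    have hζ : ζ e = 0 := by
      have := congrArg (S.ip w) hθee
      simp only [map_smul, smul_eq_mul, map_zero] at this
      simp only [ζ, LinearMap.sub_apply, LinearMap.smul_apply, smul_eq_mul, he1]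
      rw [hθ] at this ⊢
      rw [S.ip_symm e w] at *
      linear_combination this
    -- At `y = J y` the right side is `2i` times the imaginary part of `ev ζ ε y`, and `ζ` kills
    -- `e`.
    have key : ∀ s, B s (tmul w S.one) - B s (tmul S.one w) = ev ζ ε s - ev ε ζ s := by
      intro s
      induction s using tensorSq_induction with
      | add s t hs ht =>
        simp only [map_add, LinearMap.add_apply]
        linear_combination hs + ht
      | smul_tmul z a b =>
        simp only [map_smul, LinearMap.smul_apply, smul_eq_mul, hB, ev_tmul, ζ,
          LinearMap.sub_apply, hε1, hθ1, S.ip_symm a S.one, S.ip_symm b S.one, S.ip_symm w]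
        push_cast
        simp only [hε]
        ring
    have hc : ev ε ζ y = conj (ev ζ ε y) := by rw [← ev_J, hJ]
    have hr : conj (ev ζ ε y) = ev ζ ε y := Complex.conj_eq_iff_im.2 (hy ζ hζ)
    have := key y
    rw [hc, hr, sub_self] at this
    exact sub_eq_zero.1 this

end CyclicStructure

/-! ### Perturbation to a generic form -/

namespace CyclicStructure

variable {V : Type*} [AddCommGroup V] [Module ℝ V] (S : CyclicStructure V)

/-- A convex combination of two forms with the same inner product and the same unit. -/
theorem exists_convexCombination (S' : CyclicStructure V) (hip : S'.ip = S.ip)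
    (hone : S'.one = S.one) {δ : ℝ} (h0 : 0 ≤ δ) (h1 : δ ≤ 1) :
    ∃ T : CyclicStructure V, T.ip = S.ip ∧ T.one = S.one ∧
      T.form = ((1 - δ : ℝ) : ℂ) • S.form + (δ : ℂ) • S'.form := by
  have e : ∀ s t, (((1 - δ : ℝ) : ℂ) • S.form + (δ : ℂ) • S'.form) s t
      = (1 - δ) * S.form s t + δ * S'.form s t := by
    intro s t
    simp only [LinearMap.add_apply, LinearMap.smul_apply, smul_eq_mul]
    push_cast
    ring
  refine ⟨
    { ip := S.ip
      ip_symm := S.ip_symm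
      ip_pos := S.ip_pos
      one := S.one
      ip_one_one := S.ip_one_one
      form := ((1 - δ : ℝ) : ℂ) • S.form + (δ : ℂ) • S'.form
      form_hermitianPositive := (S.form_hermitianPositive.smul (sub_nonneg.2 h1)).add
        (S'.form_hermitianPositive.smul h0)
      isometric_right := fun v => by
        have := S'.isometric_right v
        rw [hip, hone] at this
        rw [e, this, S.isometric_right]
        ring
      isometric_left := fun v => by
        have := S'.isometric_left v
        rw [hip, hone] at this
        rw [e, this, S.isometric_left]
        ring
      cyclic := fun a b c d => by rw [e, e, S.cyclic, S'.cyclic]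
      selfAdjoint := fun a b c d => by
        rw [e, e, S.selfAdjoint, S'.selfAdjoint]
        simp }, rfl, rfl, rfl⟩

/-- The situation after a generic perturbation: the null vectors of the form are the multiples of
`e ⊗ 1 - 1 ⊗ e`, and `y` is a selfadjoint element, outside of `V ⊗ 1`, to be adjoined. -/
structure IsGeneric (S : CyclicStructure V) (y : TensorSq V) (e : V) : Prop where
  J_eq : J y = y
  ip_one : S.ip S.one e = 0
  normalized : e = 0 ∨ S.ip e e = 1
  comm_null : S.form (S.commOne e) (S.commOne e) = 0
  null : ∀ s, S.form s s = 0 → ∃ z : ℂ, s = z • S.commOne e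
  real : e = 0 ∨ ∀ ζ : V →ₗ[ℝ] ℝ, (ev ζ (S.ip S.one) y).im = 0
  unit : ∀ v, S.form y (tmul v S.one) = S.form y (tmul S.one v)
  not_mem : ∀ v, S.form (y - tmul v S.one) (y - tmul v S.one) ≠ 0

variable {S}

theorem form_add_null {n : TensorSq V} (hn : S.form n n = 0) (s : TensorSq V) :
    S.form (s + n) (s + n) = S.form s s := by
  have h := S.form_hermitianPositive.apply_eq_zero hn
  simp [(h s).1, (h s).2, hn]

theorem exists_isGeneric [FiniteDimensional ℝ V] {ι : Type*} [Fintype ι] (x : Module.Basis ι ℝ V)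
    (hx : S.IsOrthonormal x) {y : TensorSq V} (hJ : J y = y)
    (hy : ∀ v, ¬ S.Same y (tmul v S.one))
    (hunit : ∀ v, S.form y (tmul v S.one) = S.form y (tmul S.one v)) {r : ℝ} (hr : 0 < r) :
    ∃ T : CyclicStructure V, T.ip = S.ip ∧ T.one = S.one ∧
      (∀ i j k l, ‖S.form (tmul (x i) (x j)) (tmul (x k) (x l)) -
        T.form (tmul (x i) (x j)) (tmul (x k) (x l))‖ < r) ∧
      ∃ y' e, T.form (y - y') (y - y') = 0 ∧ T.IsGeneric y' e := by
  -- `q` is the imaginary part of the `V ⊗ 1` component of `y`. Normalising it gives `e`, the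
  -- direction in which the free form has to commute with `1`.
  obtain ⟨q, hq⟩ : ∃ q : V, ∀ ζ : V →ₗ[ℝ] ℝ, ζ q = (ev ζ (S.ip S.one) y).im := by
    let L : Module.Dual ℝ (Module.Dual ℝ V) :=
      { toFun := fun ζ => (ev ζ (S.ip S.one) y).im
        map_add' := fun ζ ζ' => by rw [ev_add_left, Complex.add_im]
        map_smul' := fun c ζ => by rw [ev_smul_left, Complex.im_ofReal_mul]; rfl }
    refine ⟨(Module.evalEquiv ℝ V).symm L, fun ζ => ?_⟩
    rw [Module.apply_evalEquiv_symm_apply]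
    rfl
  have hq1 : S.ip S.one q = 0 := by
    rw [hq, ← Complex.conj_eq_iff_im, ← ev_J, hJ]
  obtain ⟨e, ρ, hqe, he1, he⟩ : ∃ (e : V) (ρ : ℝ), q = ρ • e ∧ S.ip S.one e = 0 ∧
      (e = 0 ∨ S.ip e e = 1) := by
    by_cases h : q = 0
    · exact ⟨0, 0, by simp [h], by simp, .inl rfl⟩
    · have hpos := S.ip_pos q h
      have hs := Real.sqrt_pos.2 hpos
      refine ⟨(√(S.ip q q))⁻¹ • q, √(S.ip q q), ?_, by simp [hq1], .inr ?_⟩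
      · rw [smul_smul, mul_inv_cancel₀ hs.ne', one_smul]
      · simp only [map_smul, LinearMap.smul_apply, smul_eq_mul]
        have := Real.mul_self_sqrt hpos.le
        field_simp
        nlinarith
  obtain ⟨S', hip, hone, hnull, hcomm, hS'⟩ := S.exists_free x hx e he1 he
  have hunit' := hS' y hJ fun ζ hζ => by rw [← hq, hqe, map_smul, hζ, smul_zero]
  obtain ⟨K, hK⟩ : ∃ K : ℝ, ∀ p : ι × ι × ι × ι,
      ‖S.form (tmul (x p.1) (x p.2.1)) (tmul (x p.2.2.1) (x p.2.2.2)) -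
        S'.form (tmul (x p.1) (x p.2.1)) (tmul (x p.2.2.1) (x p.2.2.2))‖ ≤ K := by
    obtain ⟨K, hK⟩ := (Set.finite_range fun p : ι × ι × ι × ι =>
      ‖S.form (tmul (x p.1) (x p.2.1)) (tmul (x p.2.2.1) (x p.2.2.2)) -
        S'.form (tmul (x p.1) (x p.2.1)) (tmul (x p.2.2.1) (x p.2.2.2))‖).bddAbove
    exact ⟨K, fun p => hK ⟨p, rfl⟩⟩
  obtain ⟨δ, hδ0, hδ1, hδ⟩ : ∃ δ : ℝ, 0 < δ ∧ δ < 1 ∧ δ * |K| < r := by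
    refine ⟨min (1 / 2) (r / (|K| + 1)), by positivity,
      (min_le_left _ _).trans_lt (by norm_num), ?_⟩
    calc _ ≤ r / (|K| + 1) * |K| := by gcongr; exact min_le_right _ _
      _ < r := by rw [div_mul_eq_mul_div, div_lt_iff₀ (by positivity)]; nlinarith [abs_nonneg K]
  obtain ⟨T, hTip, hTone, hT⟩ := S.exists_convexCombination S' hip hone hδ0.le hδ1.le
  have hTa : ∀ s t, T.form s t = (1 - δ) * S.form s t + δ * S'.form s t := by
    intro s t
    rw [hT]
    simp only [LinearMap.add_apply, LinearMap.smul_apply, smul_eq_mul]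
    push_cast
    ring
  have hTnull : ∀ s, T.form s s = 0 → S.form s s = 0 ∧ S'.form s s = 0 := by
    intro s hs
    rw [hT] at hs
    have := (S.form_hermitianPositive.smul (sub_nonneg.2 hδ1.le)).of_add_eq_zero
      (S'.form_hermitianPositive.smul hδ0.le) hs
    simp only [LinearMap.smul_apply, smul_eq_mul, mul_eq_zero, Complex.ofReal_eq_zero, hδ0.ne',
      (sub_pos.2 hδ1).ne', false_or] at this
    exact this
  have hTunit : ∀ v, T.form y (tmul v T.one) = T.form y (tmul T.one v) := by
    intro v
    rw [hTone, hTa, hTa, hunit, hunit']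
  have hTmem : ∀ v, T.form (y - tmul v T.one) (y - tmul v T.one) ≠ 0 := by
    intro v h
    rw [hTone] at h
    exact hy v (hTnull _ h).1
  have hTcomm : T.commOne e = S.commOne e := by rw [commOne, hTone, commOne]
  refine ⟨T, hTip, hTone, ?_, ?_⟩
  · intro i j k l
    rw [hTa]
    have := hK (i, j, k, l)
    simp only at this
    calc _ = ‖(δ : ℂ) * (S.form (tmul (x i) (x j)) (tmul (x k) (x l)) -
          S'.form (tmul (x i) (x j)) (tmul (x k) (x l)))‖ := by congr 1; ring
      _ = δ * ‖S.form (tmul (x i) (x j)) (tmul (x k) (x l)) -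
          S'.form (tmul (x i) (x j)) (tmul (x k) (x l))‖ := by
        rw [norm_mul, Complex.norm_real, Real.norm_of_nonneg hδ0.le]
      _ ≤ δ * |K| := by gcongr; exact this.trans (le_abs_self K)
      _ < r := hδ
  -- If `e` commutes with `1` for `S`, it does so for `T`, and `n = iρ(e⊗1 - 1⊗e)` is null;
  -- subtracting it from `y` cancels `q`. Otherwise `T` is definite, and `e = 0` serves.
  by_cases hc : S.form (S.commOne e) (S.commOne e) = 0
  · have hTc : T.form (S.commOne e) (S.commOne e) = 0 := by rw [hTa, hc, hcomm]; ring
    set n : TensorSq V := (Complex.I * ρ) • S.commOne e with hn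
    have hnn : T.form n n = 0 := by simp [hn, hTc]
    refine ⟨y - n, e, by simpa using hnn, ?_, hTip ▸ hTone ▸ he1, hTip ▸ he, hTcomm ▸ hTc,
      fun s hs => hTcomm ▸ hnull s (hTnull s hs).2, .inr ?_, ?_, ?_⟩
    · have hJn : J n = n := by
        have h := J_smul_tmul (Complex.I * ρ) e S.one
        have h' := J_smul_tmul (Complex.I * ρ) S.one e
        rw [hn, commOne, smul_sub, map_sub, h, h', map_mul, Complex.conj_I, Complex.conj_ofReal,
          neg_mul, neg_smul, neg_smul]
        abel
      rw [map_sub, hJ, hJn]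
    · intro ζ
      rw [map_sub, Complex.sub_im, hTip, hTone, ← hq, hqe, hn, commOne]
      simp [he1, S.ip_one_one, mul_comm]
    · intro v
      have h := T.form_hermitianPositive.apply_eq_zero hnn
      rw [map_sub, LinearMap.sub_apply, LinearMap.sub_apply, (h _).1, (h _).1, hTunit]
    · intro v h
      apply hTmem v
      rw [← form_add_null hnn] at h
      convert h using 2 <;> abel_nf
  · refine ⟨y, 0, by simp, hJ, by simp, .inl rfl, by simp [commOne], ?_, .inl rfl, hTunit, hTmem⟩
    intro s hs
    obtain ⟨z, rfl⟩ := hnull s (hTnull s hs).2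
    have := (hTnull _ hs).1
    simp only [map_smulₛₗ, LinearMap.smul_apply, smul_eq_mul, mul_eq_zero, hc, or_false,
      RingHom.id_apply, map_eq_zero, or_self] at this
    exact ⟨0, by simp [this]⟩

end CyclicStructure

/-! ### Cubic forms and the reality of their contraction with `y` -/

namespace CyclicStructure

variable {V : Type*} [AddCommGroup V] [Module ℝ V] (S : CyclicStructure V)

/-- The bilinear map `(a, b) ↦ ≪y, a ⊗ b≫`. -/
def pairing (y : TensorSq V) : V →ₗ[ℝ] V →ₗ[ℝ] ℂ :=
  LinearMap.mk₂ ℝ (fun a b => S.form y (tmul a b))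
    (fun a a' b => by rw [tmul_add_left, map_add])
    (fun r a b => by rw [tmul_smul_left, map_smulₛₗ, Complex.conj_ofReal]; rfl)
    (fun a b b' => by rw [tmul_add_right, map_add])
    (fun r a b => by rw [tmul_smul_right, map_smulₛₗ, Complex.conj_ofReal]; rfl)

/-- The conditions on `F(c, a, b) = τ(Y c a b)` that come from the symmetries of a cyclic form and
from `y ≡ Y ⊗ 1 ≡ 1 ⊗ Y`, where `e ⊗ 1 ≡ 1 ⊗ e`. -/
structure IsCubic (y : TensorSq V) (e : V) (F : V →ₗ[ℝ] V →ₗ[ℝ] V →ₗ[ℝ] ℂ) : Prop where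
  conj_eq : ∀ c a b, conj (F c a b) = F b a c
  one_left : ∀ a b, F S.one a b = S.form y (tmul b a)
  one_mid : ∀ c, F c S.one e = F c e S.one

variable {S} {y : TensorSq V} {e : V}

theorem conj_form_tmul (hJ : J y = y) (a b : V) :
    conj (S.form y (tmul a b)) = S.form y (tmul b a) := by
  have h := J_smul_tmul 1 a b
  simp only [one_smul, map_one] at h
  rw [← S.form_J, hJ, h]

theorem IsCubic.one_right (hJ : J y = y) {F : V →ₗ[ℝ] V →ₗ[ℝ] V →ₗ[ℝ] ℂ}
    (hF : S.IsCubic y e F) (c a : V) : F c a S.one = S.form y (tmul a c) := by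
  rw [← hF.conj_eq, hF.one_left, conj_form_tmul hJ]

theorem IsCubic.contr_one (hJ : J y = y) {F : V →ₗ[ℝ] V →ₗ[ℝ] V →ₗ[ℝ] ℂ}
    (hF : S.IsCubic y e F) : contr (F S.one) y = S.form y y := by
  have : ∀ s, contr (F S.one) s = conj (S.form (J s) y) := by
    intro s
    induction s using tensorSq_induction with
    | add s t hs ht => simp only [map_add, LinearMap.add_apply, hs, ht]
    | smul_tmul z a b =>
      rw [J_smul_tmul, map_smul, contr_tmul, hF.one_left, map_smul, LinearMap.smul_apply,
        smul_eq_mul, smul_eq_mul, map_mul, Complex.conj_conj,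
        ← S.form_hermitianPositive.hermitian]
  rw [this, hJ, ← S.form_hermitianPositive.hermitian]

theorem IsGeneric.exists_isCubic (hG : S.IsGeneric y e) : ∃ F, S.IsCubic y e F := by
  set ε := S.ip S.one with hε
  set θ := S.ip e with hθ
  set Q := S.pairing y with hQ
  have hε1 : ε S.one = 1 := S.ip_one_one
  have hεe : ε e = 0 := hG.ip_one
  have hθ1 : θ S.one = 0 := by rw [hθ, S.ip_symm]; exact hεe
  have hc : ∀ a b, conj (Q a b) = Q b a := fun a b => conj_form_tmul hG.J_eq a b
  have h1 : ∀ a, Q a S.one = Q S.one a := hG.unit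
  -- The first three terms interpolate the values prescribed when `c` or `b` is `1`. The terms with
  -- `ε a` vanish in those cases and enforce the exchange of `1` and `e` in the last two slots.
  let f : V → V → V → ℂ := fun c a b =>
    ε c * Q b a + ε b * Q a c - ε c * ε b * Q S.one a
      + ε a * (θ b * (Q e c - ε c * Q S.one e) + θ c * (Q b e - ε b * Q S.one e)
        - θ b * θ c * Q e e)
  let F : V →ₗ[ℝ] V →ₗ[ℝ] V →ₗ[ℝ] ℂ := LinearMap.mk₂ ℝ (fun c a =>
      { toFun := f c a
        map_add' := fun b b' => by
          simp only [f, map_add, LinearMap.add_apply, Complex.ofReal_add]; ring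
        map_smul' := fun r b => by
          simp only [f, map_smul, LinearMap.smul_apply, smul_eq_mul, Complex.ofReal_mul,
            Complex.real_smul, RingHom.id_apply]; ring })
    (fun c c' a => by
      ext b
      simp only [LinearMap.coe_mk, AddHom.coe_mk, f, map_add, LinearMap.add_apply,
        Complex.ofReal_add]; ring)
    (fun r c a => by
      ext b
      simp only [LinearMap.coe_mk, AddHom.coe_mk, f, map_smul, LinearMap.smul_apply, smul_eq_mul,
        Complex.ofReal_mul, Complex.real_smul]; ring)
    (fun c a a' => by
      ext b
      simp only [LinearMap.coe_mk, AddHom.coe_mk, f, map_add, LinearMap.add_apply,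
        Complex.ofReal_add]; ring)
    (fun r c a => by
      ext b
      simp only [LinearMap.coe_mk, AddHom.coe_mk, f, map_smul, LinearMap.smul_apply, smul_eq_mul,
        Complex.ofReal_mul, Complex.real_smul]; ring)
  have hF : ∀ c a b, F c a b = f c a b := fun c a b => rfl
  refine ⟨F, ?_, ?_, ?_⟩
  · intro c a b
    rw [hF, hF]
    simp only [f, map_add, map_sub, map_mul, Complex.conj_ofReal, hc, h1]
    ring
  · intro a b
    rw [hF]
    simp only [f, hε1, hθ1, h1, Complex.ofReal_one, Complex.ofReal_zero]
    change _ = Q b a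
    ring
  · intro c
    rw [hF, hF]
    rcases hG.normalized with h | h
    · subst h
      simp [f]
    · have hθe : θ e = 1 := h
      simp only [f, hε1, hθ1, hθe, hεe, h1, Complex.ofReal_one, Complex.ofReal_zero]
      ring

theorem form_swap_left (hc : S.form (S.commOne e) (S.commOne e) = 0) (t : TensorSq V) :
    S.form (tmul e S.one) t = S.form (tmul S.one e) t := by
  have := (S.form_hermitianPositive.apply_eq_zero hc t).1
  rwa [commOne, map_sub, LinearMap.sub_apply, sub_eq_zero] at this

theorem form_swap_right (hc : S.form (S.commOne e) (S.commOne e) = 0) (t : TensorSq V) :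
    S.form t (tmul e S.one) = S.form t (tmul S.one e) := by
  have := (S.form_hermitianPositive.apply_eq_zero hc t).2
  rwa [commOne, map_sub, sub_eq_zero] at this

/-- In words: conjugation reverses, cyclicity rotates, and `hc` exchanges adjacent letters `e` and
`1`; these moves carry `τ(ex11)` to `τ(11xe)`. -/
theorem conj_form_one_one (hc : S.form (S.commOne e) (S.commOne e) = 0) (x : V) :
    conj (S.form (tmul S.one S.one) (tmul e x)) = S.form (tmul S.one S.one) (tmul e x) := by
  rw [← S.selfAdjoint, S.cyclic S.one S.one x e, form_swap_right hc, S.cyclic x S.one S.one e,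
    S.cyclic S.one x e S.one, S.cyclic e S.one S.one x, ← form_swap_left hc, ← S.cyclic]

theorem conj_form_right_one (p x : V) : conj (S.form (tmul p S.one) (tmul e x))
    = S.form (tmul x S.one) (tmul e p) := by
  rw [S.form_conj, S.cyclic, S.cyclic, S.cyclic]

theorem conj_form_one_left (hc : S.form (S.commOne e) (S.commOne e) = 0) (p x : V) :
    conj (S.form (tmul S.one p) (tmul e x)) = S.form (tmul S.one x) (tmul e p) := by
  rw [← S.selfAdjoint, S.cyclic, form_swap_right hc, S.cyclic]

/-- The element `α 1 ⊗ 1 + p ⊗ 1 + 1 ⊗ p + l o ⊗ o`. -/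
def special (S : CyclicStructure V) (α l : ℝ) (p o : V) : TensorSq V :=
  (α : ℂ) • tmul S.one S.one + (tmul p S.one + tmul S.one p) + (l : ℂ) • tmul o o

theorem form_special (α l : ℝ) (p o : V) (t : TensorSq V) :
    S.form (S.special α l p o) t = α * S.form (tmul S.one S.one) t
      + (S.form (tmul p S.one) t + S.form (tmul S.one p) t) + l * S.form (tmul o o) t := by
  simp [special]

theorem conj_form_special_of_eq_add (hc : S.form (S.commOne e) (S.commOne e) = 0)
    (α l μ ν : ℝ) (o : V) :
    conj (S.form (S.special α l (μ • o + ν • e) o) (tmul e o))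
      = S.form (S.special α l (μ • o + ν • e) o) (tmul e o) := by
  have h3 : conj (S.form (tmul o o) (tmul e o)) = S.form (tmul o o) (tmul e o) := by
    rw [S.form_conj, S.cyclic e o o o, S.cyclic o e o o, S.cyclic o o o e]
  have h4 : conj (S.form (tmul S.one e) (tmul e o)) = S.form (tmul S.one e) (tmul e o) := by
    rw [conj_form_one_left hc, S.cyclic S.one o e e, form_swap_left hc]
  simp only [form_special, tmul_add_left, tmul_add_right, tmul_smul_left, tmul_smul_right, map_add,
    map_smul, LinearMap.add_apply, LinearMap.smul_apply, smul_eq_mul, map_mul, Complex.conj_ofReal,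
    conj_form_one_one hc, conj_form_right_one o o, conj_form_one_left hc o o, h3, h4,
    form_swap_left hc]

theorem conj_form_special_of_eq_smul (hc : S.form (S.commOne e) (S.commOne e) = 0)
    (α l ν : ℝ) (p : V) :
    conj (S.form (S.special α l p (ν • e)) (tmul e p))
      = S.form (S.special α l p (ν • e)) (tmul e p) := by
  have h3 : conj (S.form (tmul e e) (tmul e p)) = S.form (tmul e e) (tmul e p) := by
    rw [← S.selfAdjoint, S.cyclic e e p e, S.cyclic p e e e, S.cyclic e p e e]
  simp only [form_special, tmul_smul_left, tmul_smul_right, map_add,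
    map_smul, LinearMap.smul_apply, smul_eq_mul, map_mul, Complex.conj_ofReal,
    conj_form_one_one hc, conj_form_right_one p p, conj_form_one_left hc p p, h3]

theorem IsCubic.contr_special {F : V →ₗ[ℝ] V →ₗ[ℝ] V →ₗ[ℝ] ℂ} (α l : ℝ) (p o : V) :
    contr (F o) (S.special α l p o)
      = α * F o S.one S.one + (F o p S.one + F o S.one p) + l * F o o o := by
  simp [special]

/-- Expanding `y` leaves `F o 1 o` and `F o o o`, real because they are palindromes, and values of
`≪y, ·≫` that are real by the symmetries; the only delicate one, at `e⊗o`, is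
`conj_form_special_of_eq_add`. -/
theorem IsGeneric.conj_contr_of_eq_add (hG : S.IsGeneric y e) {F : V →ₗ[ℝ] V →ₗ[ℝ] V →ₗ[ℝ] ℂ}
    (hF : S.IsCubic y e F) {α l μ ν : ℝ} {o : V} (hy : y = S.special α l (μ • o + ν • e) o) :
    conj (contr (F o) y) = contr (F o) y := by
  have hc := conj_form_special_of_eq_add hG.comm_null α l μ ν o
  have h1 : contr (F o) y = α * S.form y (tmul S.one o)
      + (μ * (S.form y (tmul o o) + F o S.one o) + 2 * ν * S.form y (tmul e o)) + l * F o o o := by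
    conv_lhs => rw [hy, IsCubic.contr_special]
    simp only [map_add, map_smul, LinearMap.add_apply, LinearMap.smul_apply, hF.one_mid,
      hF.one_right hG.J_eq, Complex.real_smul]
    ring
  rw [← hy] at hc
  rw [h1]
  simp only [map_add, map_mul, Complex.conj_ofReal, hF.conj_eq, hc, conj_form_tmul hG.J_eq o o,
    conj_form_tmul hG.J_eq S.one o, hG.unit, map_ofNat]

theorem IsGeneric.conj_contr_of_eq_smul (hG : S.IsGeneric y e) {F : V →ₗ[ℝ] V →ₗ[ℝ] V →ₗ[ℝ] ℂ}
    (hF : S.IsCubic y e F) {α l ν : ℝ} {p : V} (hy : y = S.special α l p (ν • e)) :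
    conj (contr (F (ν • e)) y) = contr (F (ν • e)) y := by
  have hc := conj_form_special_of_eq_smul hG.comm_null α l ν p
  rw [← hy] at hc
  have hc' : S.form y (tmul p e) = S.form y (tmul e p) := by rw [← hc, conj_form_tmul hG.J_eq]
  have h0 : F e S.one p = S.form y (tmul e p) := by
    rw [← hF.conj_eq, hF.one_mid, hF.one_right hG.J_eq, hc]
  have h1 : contr (F (ν • e)) y = α * ν * S.form y (tmul S.one e)
      + 2 * ν * S.form y (tmul e p) + l * ν ^ 3 * F e e e := by
    conv_lhs => rw [hy, IsCubic.contr_special]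
    simp only [map_smul, LinearMap.smul_apply, h0,
      hF.one_right hG.J_eq, Complex.real_smul, hc']
    ring
  rw [h1]
  simp only [map_add, map_mul, map_pow, Complex.conj_ofReal, hF.conj_eq, hc,
    conj_form_tmul hG.J_eq S.one e, hG.unit, map_ofNat]

/-- `o` is orthogonal to every correction of a cubic form. -/
def IsObstruction (S : CyclicStructure V) (y : TensorSq V) (e o : V) : Prop :=
  ∀ F : V →ₗ[ℝ] V →ₗ[ℝ] V →ₗ[ℝ] ℂ, (∀ c a b, conj (F c a b) = F b a c) → F S.one = 0 →
    (∀ c, F c S.one e = 0) → (contr (F o) y).im = 0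

/-- The obstruction is tested on `ξ⊗η⊗ζ + ζ⊗η⊗ξ` and on `i(ξ⊗η⊗ζ - ζ⊗η⊗ξ)`, which control the
imaginary and the real part. Hypothesis `h` makes both admissible corrections. -/
theorem IsObstruction.ev_eq {o : V} (ho : S.IsObstruction y e o) {ξ η ζ : V →ₗ[ℝ] ℝ}
    (hξ : ξ S.one = 0) (hξo : ξ o = 1) (hζ : ζ S.one = 0)
    (h : η S.one = 0 ∨ ξ e = 0 ∧ ζ e = 0) :
    ev η ζ y = ((ζ o * (ev η ξ y).re : ℝ) : ℂ) := by
  have contr_I : ∀ β : V →ₗ[ℝ] V →ₗ[ℝ] ℂ, contr (Complex.I • β) = Complex.I • contr β :=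
    fun β => linearMap_ext fun a b => by simp
  have him : ∀ ζ : V →ₗ[ℝ] ℝ, ζ S.one = 0 → (η S.one = 0 ∨ ξ e = 0 ∧ ζ e = 0) →
      (ev η ζ y).im + ζ o * (ev η ξ y).im = 0 := by
    intro ζ hζ h
    have := ho (ξ.smulRight (prodForm η ζ) + ζ.smulRight (prodForm η ξ))
      (fun c a b => by simp; ring) (by ext; simp [hξ, hζ])
      (fun c => by rcases h with h | h <;> simp [h])
    simpa [ev, contr_add, contr_smul, hξo] using this
  have hre : (ev η ζ y).re - ζ o * (ev η ξ y).re = 0 := by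
    have := ho (ξ.smulRight (Complex.I • prodForm η ζ) - ζ.smulRight (Complex.I • prodForm η ξ))
      (fun c a b => by simp; ring) (by ext; simp [hξ, hζ])
      (fun c => by rcases h with h | h <;> simp [h])
    simpa [ev, contr_sub, contr_smul, contr_I, hξo] using this
  have h1 := him ξ hξ (by tauto)
  rw [hξo, one_mul] at h1
  have h2 : (ev η ξ y).im = 0 := by linarith
  have h3 := him ζ hζ h
  rw [h2, mul_zero, add_zero] at h3
  apply Complex.ext
  · rw [Complex.ofReal_re]; linarith
  · rw [Complex.ofReal_im, h3]

theorem eq_special [FiniteDimensional ℝ V] (hJ : J y = y) {l : ℝ} {p o : V}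
    (ho : S.ip S.one o = 0) (hp : S.ip S.one p = 0)
    (hl : ∀ η ζ : V →ₗ[ℝ] ℝ, η S.one = 0 → ζ S.one = 0 → ev η ζ y = l * η o * ζ o)
    (hζ : ∀ ζ : V →ₗ[ℝ] ℝ, ζ S.one = 0 → ev ζ (S.ip S.one) y = ζ p) :
    y = S.special (ev (S.ip S.one) (S.ip S.one) y).re l p o := by
  set ε := S.ip S.one with hε
  have hα : ev ε ε y = ((ev ε ε y).re : ℂ) := by
    rw [eq_comm, ← Complex.conj_eq_iff_re, ← ev_J, hJ]
  have hζ' : ∀ ζ : V →ₗ[ℝ] ℝ, ζ S.one = 0 → ev ε ζ y = ζ p := by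
    intro ζ h
    rw [← Complex.conj_ofReal, ← hζ ζ h, ← ev_J, hJ]
  have hε1 : ε S.one = 1 := S.ip_one_one
  refine ev_ext fun η ζ => ?_
  have hη0 : (η - η S.one • ε) S.one = 0 := by simp [hε1]
  have hζ0 : (ζ - ζ S.one • ε) S.one = 0 := by simp [hε1]
  have dη : η = (η - η S.one • ε) + η S.one • ε := by abel
  have dζ : ζ = (ζ - ζ S.one • ε) + ζ S.one • ε := by abel
  have : ev η ζ y = l * η o * ζ o + ζ S.one * η p + η S.one * ζ p
      + η S.one * ζ S.one * (ev ε ε y).re := by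
    conv_lhs => rw [dη, dζ, ev_add_left, ev_add_right, ev_add_right, ev_smul_left, ev_smul_left,
      ev_smul_right, ev_smul_right, hl _ _ hη0 hζ0, hζ _ hη0, hζ' _ hζ0, hα]
    simp [ho, hp]
    ring
  rw [this]
  simp [special]
  ring

/-- An obstruction makes the part of `y` orthogonal to `1` on both sides a multiple of `o⊗o`, and
leaves a mixed part `p⊗1 + 1⊗p`. Either `o` is a multiple of `e`, or `p` lies in the span of `o` and
`e`; each case has its own computation above. -/
theorem IsGeneric.conj_contr_of_isObstruction [FiniteDimensional ℝ V] (hG : S.IsGeneric y e)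
    {F : V →ₗ[ℝ] V →ₗ[ℝ] V →ₗ[ℝ] ℂ} (hF : S.IsCubic y e F) {o : V} (ho1 : S.ip S.one o = 0)
    (ho : S.IsObstruction y e o) : conj (contr (F o) y) = contr (F o) y := by
  by_cases ho0 : o = 0
  · simp [ho0]
  set ε := S.ip S.one with hε
  have hε1 : ε S.one = 1 := S.ip_one_one
  have hoo := S.ip_pos o ho0
  let ξ : V →ₗ[ℝ] ℝ := (S.ip o o)⁻¹ • S.ip o
  have hξ1 : ξ S.one = 0 := by simp [ξ, S.ip_symm o S.one, ← hε, ho1]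
  have hξo : ξ o = 1 := by simp [ξ, hoo.ne']
  have hl : ∀ η ζ : V →ₗ[ℝ] ℝ, η S.one = 0 → ζ S.one = 0 →
      ev η ζ y = (ev ξ ξ y).re * η o * ζ o := by
    intro η ζ hη hζ
    have h1 := ho.ev_eq hξ1 hξo hζ (.inl hη)
    have h2 := ho.ev_eq hξ1 hξo hη (.inl hξ1)
    have h3 : ev η ξ y = conj (ev ξ η y) := by rw [← ev_J, hG.J_eq]
    rw [h1, h3, h2, Complex.conj_ofReal, Complex.ofReal_re]
    push_cast
    ring
  have evJ : ∀ ζ, ev ζ ε y = conj (ev ε ζ y) := fun ζ => by rw [← ev_J, hG.J_eq]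
  rcases eq_or_ne e 0 with he | he
  · have hp : ∀ ζ : V →ₗ[ℝ] ℝ, ζ S.one = 0 →
        ev ζ ε y = ζ ((ev ε ξ y).re • o + (0 : ℝ) • e) := by
      intro ζ hζ
      rw [evJ, ho.ev_eq hξ1 hξo hζ (.inr (by simp [he])), Complex.conj_ofReal]
      simp [mul_comm]
    exact hG.conj_contr_of_eq_add hF (eq_special hG.J_eq ho1 (by simp [← hε, ho1]) hl hp)
  · have hreal := hG.real.resolve_left he
    have hee := hG.normalized.resolve_left he
    have hεe : ε e = 0 := hG.ip_one
    set θ := S.ip e with hθ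
    obtain ⟨p, hp1, hp⟩ : ∃ p : V, ε p = 0 ∧ ∀ ζ : V →ₗ[ℝ] ℝ, ζ S.one = 0 → ev ζ ε y = ζ p := by
      let L : Module.Dual ℝ (Module.Dual ℝ V) :=
        { toFun := fun ζ => (ev ζ ε y).re
          map_add' := fun ζ ζ' => by rw [ev_add_left, Complex.add_re]
          map_smul' := fun c ζ => by rw [ev_smul_left, Complex.re_ofReal_mul]; rfl }
      let p := (Module.evalEquiv ℝ V).symm L
      have hp : ∀ ζ : V →ₗ[ℝ] ℝ, ζ p = (ev ζ ε y).re := fun ζ => by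
        rw [Module.apply_evalEquiv_symm_apply]
        rfl
      refine ⟨p - ε p • S.one, by simp [hε1], fun ζ hζ => ?_⟩
      rw [map_sub, map_smul, hζ, smul_zero, sub_zero, hp]
      apply Complex.ext <;> simp [hε, hreal ζ]
    have hy := eq_special hG.J_eq ho1 hp1 hl hp
    have proj : ∀ v : V, ε v = 0 → S.ip (v - θ v • e) S.one = 0 ∧ S.ip (v - θ v • e) e = 0 ∧
        S.ip (v - θ v • e) (v - θ v • e) = S.ip (v - θ v • e) v := by
      intro v hv
      have h1 : S.ip (v - θ v • e) S.one = 0 := by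
        rw [S.ip_symm]; simp [← hε, hv, hεe]
      have h2 : S.ip (v - θ v • e) e = 0 := by
        rw [S.ip_symm, ← hθ]; simp [hee]
      refine ⟨h1, h2, ?_⟩
      rw [map_sub (S.ip _), map_smul (S.ip _), h2]
      simp
    by_cases h_proj : o - θ o • e = 0
    · rw [sub_eq_zero] at h_proj
      rw [h_proj] at hy ⊢
      exact hG.conj_contr_of_eq_smul hF hy
    · obtain ⟨h1, h2, h3⟩ := proj o ho1
      have hpos := S.ip_pos _ h_proj
      rw [h3] at hpos
      -- Testing slots containing `1` requires functionals that also kill `e`, so `ξ` is replaced by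
      -- one dual to the part of `o` orthogonal to `e`.
      let χ : V →ₗ[ℝ] ℝ := (S.ip (o - θ o • e) o)⁻¹ • S.ip (o - θ o • e)
      have hχ1 : χ S.one = 0 := by simp only [χ, LinearMap.smul_apply, h1, smul_zero]
      have hχe : χ e = 0 := by simp only [χ, LinearMap.smul_apply, h2, smul_zero]
      have hχo : χ o = 1 := by
        simp only [χ, LinearMap.smul_apply, smul_eq_mul]
        exact inv_mul_cancel₀ hpos.ne'
      set μ := (ev ε χ y).re
      have hμ : ∀ ζ : V →ₗ[ℝ] ℝ, ζ S.one = 0 → ζ e = 0 → ζ p = ζ o * μ := by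
        intro ζ hζ hζe
        have := hp ζ hζ
        rw [evJ, ho.ev_eq hχ1 hχo hζ (.inr ⟨hχe, hζe⟩), Complex.conj_ofReal] at this
        exact_mod_cast this.symm
      have hpμ : p = μ • o + θ (p - μ • o) • e := by
        obtain ⟨k1, k2, k3⟩ := proj (p - μ • o) (by simp [hp1, ho1])
        have k5 : ∀ ζ : V →ₗ[ℝ] ℝ, ζ S.one = 0 → ζ e = 0 → ζ (p - μ • o) = 0 := by
          intro ζ hζ hζe
          rw [map_sub, map_smul, hμ ζ hζ hζe, smul_eq_mul, mul_comm, sub_self]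
        rw [k5 _ k1 k2] at k3
        have k4 : p - μ • o - θ (p - μ • o) • e = 0 := by
          by_contra hne
          exact (S.ip_pos _ hne).ne' k3
        rw [sub_sub, sub_eq_zero] at k4
        exact k4
      rw [hpμ] at hy
      exact hG.conj_contr_of_eq_add hF hy

/-- A cubic form for which `τ(Y 1 Y c)` is real. -/
theorem IsGeneric.exists_real_isCubic [FiniteDimensional ℝ V] (hG : S.IsGeneric y e) :
    ∃ F, S.IsCubic y e F ∧ ∀ c, conj (contr (F c) y) = contr (F c) y := by
  obtain ⟨F₀, hF₀⟩ := hG.exists_isCubic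
  let H : Submodule ℝ (V →ₗ[ℝ] V →ₗ[ℝ] V →ₗ[ℝ] ℂ) :=
    { carrier := {F | (∀ c a b, conj (F c a b) = F b a c) ∧ F S.one = 0 ∧ ∀ c, F c S.one e = 0}
      add_mem' := fun hF hF' => ⟨fun c a b => by simp [hF.1, hF'.1],
        by simp [hF.2.1, hF'.2.1], fun c => by simp [hF.2.2, hF'.2.2]⟩
      zero_mem' := by simp
      smul_mem' := fun r F hF => ⟨fun c a b => by simp [hF.1], by simp [hF.2.1],
        fun c => by simp [hF.2.2]⟩ }
  let Λ : (V →ₗ[ℝ] V →ₗ[ℝ] V →ₗ[ℝ] ℂ) →ₗ[ℝ] Module.Dual ℝ V :=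
    LinearMap.mk₂ ℝ (fun F c => (contr (F c) y).im)
      (fun F F' c => by simp [contr_add]) (fun r F c => by simp [contr_smul])
      (fun F c c' => by simp [contr_add]) (fun r F c => by simp [contr_smul])
  have hΛ : ∀ F c, Λ F c = (contr (F c) y).im := fun F c => rfl
  -- The imaginary parts to be cancelled form a functional on `V`; it is attained by corrections as
  -- soon as it vanishes on every vector that they all annihilate. The `1` component of such a
  -- vector is harmless, since the contraction at `1` is `≪y, y≫`.
  have hmem : Λ F₀ ∈ H.map Λ := by
    rw [← Subspace.dualCoannihilator_dualAnnihilator_eq (W := H.map Λ),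
      Submodule.mem_dualAnnihilator]
    intro o ho
    rw [Submodule.mem_dualCoannihilator] at ho
    have h1 : Λ F₀ S.one = 0 := by
      rw [hΛ, hF₀.contr_one hG.J_eq, S.form_hermitianPositive.im_self]
    have ho' : S.IsObstruction y e (o - S.ip S.one o • S.one) := by
      intro F hF hF1 hFe
      have := ho (Λ F) ⟨F, ⟨hF, hF1, hFe⟩, rfl⟩
      rw [← hΛ, map_sub, map_smul, this, hΛ, hF1]
      simp
    have := hG.conj_contr_of_isObstruction hF₀ (by simp [S.ip_one_one]) ho'
    rw [Complex.conj_eq_iff_im, ← hΛ, map_sub, map_smul, h1, smul_zero, sub_zero] at this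
    exact this
  obtain ⟨F₁, hF₁, h⟩ := hmem
  refine ⟨F₀ - F₁, ⟨fun c a b => ?_, fun a b => ?_, fun c => ?_⟩, fun c => ?_⟩
  · simp [hF₀.conj_eq, hF₁.1]
  · simp [hF₀.one_left, hF₁.2.1]
  · have : F₁ c e S.one = 0 := by rw [← hF₁.1, hF₁.2.1]; simp
    simp [hF₀.one_mid, hF₁.2.2, this]
  · rw [Complex.conj_eq_iff_im, LinearMap.sub_apply, contr_sub, LinearMap.sub_apply,
      Complex.sub_im, ← hΛ, ← hΛ, h, sub_self]

end CyclicStructure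

theorem hermitian_of_tmul {V : Type*} [AddCommGroup V] [Module ℝ V] {B : SesqForm V}
    (h : ∀ a b c d, B (tmul a b) (tmul c d) = conj (B (tmul c d) (tmul a b))) (s t : TensorSq V) :
    B s t = conj (B t s) := by
  induction s using tensorSq_induction with
  | add s s' hs hs' => simp only [map_add, LinearMap.add_apply, hs, hs']
  | smul_tmul z a b =>
    induction t using tensorSq_induction with
    | add t t' ht ht' => simp only [map_add, LinearMap.add_apply, ht, ht']
    | smul_tmul w c d =>
      simp only [map_smulₛₗ, LinearMap.smul_apply, smul_eq_mul, h a b c d, map_mul,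
        Complex.conj_conj, RingHom.id_apply]
      ring

/-! ### The form on `V ⊕ ℝY` given by words of length four -/

namespace CyclicStructure

variable {V : Type*} [AddCommGroup V] [Module ℝ V] {S : CyclicStructure V} {y : TensorSq V} {e : V}

/-- A real bilinear form, with complex values. -/
def toComplexForm (g : V →ₗ[ℝ] V →ₗ[ℝ] ℝ) : V →ₗ[ℝ] V →ₗ[ℝ] ℂ :=
  g.compr₂ Complex.ofRealCLM.toLinearMap

@[simp] theorem toComplexForm_apply (g : V →ₗ[ℝ] V →ₗ[ℝ] ℝ) (a b : V) :
    toComplexForm g a b = g a b := rfl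

/-- The value `τ(a b c d)` on `V ⊕ ℝY`, given `F(a, b, c) = τ(Y a b c)`, `g(a, b) = τ(Y Y a b)`,
`k(a, b) = τ(Y a Y b)`, `m(a) = τ(Y Y Y a)` and `D = τ(Y Y Y Y)`. -/
def word (S : CyclicStructure V) (F : V →ₗ[ℝ] V →ₗ[ℝ] V →ₗ[ℝ] ℂ) (g k : V →ₗ[ℝ] V →ₗ[ℝ] ℝ)
    (m : V →ₗ[ℝ] ℝ) (D : ℝ) (a b c d : V × ℝ) : ℂ :=
  S.form (tmul a.1 b.1) (tmul d.1 c.1)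
    + (a.2 * F b.1 c.1 d.1 + b.2 * F c.1 d.1 a.1 + c.2 * F d.1 a.1 b.1 + d.2 * F a.1 b.1 c.1)
    + (a.2 * b.2 * g c.1 d.1 + b.2 * c.2 * g d.1 a.1 + c.2 * d.2 * g a.1 b.1
      + d.2 * a.2 * g b.1 c.1)
    + (a.2 * c.2 * k b.1 d.1 + b.2 * d.2 * k a.1 c.1)
    + (a.2 * b.2 * c.2 * m d.1 + b.2 * c.2 * d.2 * m a.1 + c.2 * d.2 * a.2 * m b.1
      + d.2 * a.2 * b.2 * m c.1)
    + a.2 * b.2 * c.2 * d.2 * D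

/-- The conditions under which `word` defines an extension of `S` by `Y ≡ y`. -/
structure IsExtensionData (S : CyclicStructure V) (y : TensorSq V) (e : V)
    (F : V →ₗ[ℝ] V →ₗ[ℝ] V →ₗ[ℝ] ℂ) (g k : V →ₗ[ℝ] V →ₗ[ℝ] ℝ) (m : V →ₗ[ℝ] ℝ) : Prop where
  J_eq : J y = y
  cubic : S.IsCubic y e F
  g_symm : ∀ a b, g a b = g b a
  k_symm : ∀ a b, k a b = k b a
  contr_F : ∀ c, contr (F c) y = g S.one c
  k_one : ∀ c, k S.one c = g S.one c
  contr_g : contr (toComplexForm g) y = m S.one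

/-- The form `Φ` has the values prescribed by `word`. -/
def IsWordForm (S : CyclicStructure V) (F : V →ₗ[ℝ] V →ₗ[ℝ] V →ₗ[ℝ] ℂ)
    (g k : V →ₗ[ℝ] V →ₗ[ℝ] ℝ) (m : V →ₗ[ℝ] ℝ) (D : ℝ) (Φ : SesqForm (V × ℝ)) : Prop :=
  ∀ a b c d, Φ (tmul a b) (tmul c d) = S.word F g k m D a b d c

variable {F : V →ₗ[ℝ] V →ₗ[ℝ] V →ₗ[ℝ] ℂ} {g k : V →ₗ[ℝ] V →ₗ[ℝ] ℝ} {m : V →ₗ[ℝ] ℝ} {D : ℝ}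
  {Φ : SesqForm (V × ℝ)}

theorem exists_isWordForm (S : CyclicStructure V) (F : V →ₗ[ℝ] V →ₗ[ℝ] V →ₗ[ℝ] ℂ)
    (g k : V →ₗ[ℝ] V →ₗ[ℝ] ℝ) (m : V →ₗ[ℝ] ℝ) (D : ℝ) : ∃ Φ, S.IsWordForm F g k m D Φ := by
  refine exists_sesqForm (fun a b c d => S.word F g k m D a b d c) ?_ ?_ ?_ ?_ ?_ ?_ ?_ ?_
  all_goals
    intros
    simp only [word, Prod.fst_add, Prod.snd_add, Prod.smul_fst, Prod.smul_snd, tmul_add_left,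
      tmul_add_right, tmul_smul_left, tmul_smul_right, map_add, map_smulₛₗ, LinearMap.add_apply,
      LinearMap.smul_apply, smul_eq_mul, Complex.ofReal_add, Complex.ofReal_mul,
      Complex.conj_ofReal, Complex.real_smul, RingHom.id_apply]
    ring

theorem word_cyclic (hE : S.IsExtensionData y e F g k m) (a b c d : V × ℝ) :
    S.word F g k m D a b c d = S.word F g k m D d a b c := by
  simp only [word]
  rw [S.cyclic a.1 b.1 d.1 c.1, hE.k_symm b.1 d.1]
  ring

theorem conj_word (hE : S.IsExtensionData y e F g k m) (a b c d : V × ℝ) :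
    conj (S.word F g k m D a b c d) = S.word F g k m D d c b a := by
  simp only [word, map_add, map_mul, Complex.conj_ofReal, hE.cubic.conj_eq, S.form_conj]
  rw [hE.g_symm c.1 d.1, hE.g_symm d.1 a.1, hE.g_symm a.1 b.1, hE.g_symm b.1 c.1,
    hE.k_symm b.1 d.1, hE.k_symm a.1 c.1]
  ring

/-- The inclusion of `(V ⊗ V) ⊗ ℂ` into `(W ⊗ W) ⊗ ℂ`, where `W = V ⊕ ℝY`. -/
abbrev incl : TensorSq V →ₗ[ℂ] TensorSq (V × ℝ) := mapSq (LinearMap.inl ℝ V ℝ)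

namespace IsWordForm

theorem hermitian (hΦ : S.IsWordForm F g k m D Φ) (hE : S.IsExtensionData y e F g k m)
    (s t : TensorSq (V × ℝ)) : Φ s t = conj (Φ t s) :=
  hermitian_of_tmul (fun a b c d => by rw [hΦ, hΦ, conj_word hE]) s t

/-- The word `abdY` rotates to `F(a,b,d)`, the conjugate of `F(d,b,a)`; hence the flip and the
conjugations in the third term. -/
theorem apply_incl_tmul (hΦ : S.IsWordForm F g k m D Φ) (hE : S.IsExtensionData y e F g k m)
    (s : TensorSq V) (c d : V × ℝ) :
    Φ (incl s) (tmul c d) = S.form s (tmul c.1 d.1) + d.2 * contr (F c.1) s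
      + c.2 * conj (contr (F d.1) (J s)) + c.2 * d.2 * contr (toComplexForm g) s := by
  induction s using tensorSq_induction with
  | add s t hs ht =>
    simp only [map_add, LinearMap.add_apply, hs, ht]
    ring
  | smul_tmul z a b =>
    rw [J_smul_tmul]
    simp only [map_smul, LinearMap.smul_apply, smul_eq_mul, mapSq_tmul, hΦ _ _ _ _, contr_tmul,
      map_mul, Complex.conj_conj, hE.cubic.conj_eq, toComplexForm_apply, word,
      LinearMap.inl_apply, Complex.ofReal_zero]
    ring

theorem apply_incl_incl (hΦ : S.IsWordForm F g k m D Φ) (s t : TensorSq V) :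
    Φ (incl s) (incl t) = S.form s t := by
  induction s using tensorSq_induction with
  | add s s' hs hs' => simp only [map_add, LinearMap.add_apply, hs, hs']
  | smul_tmul z a b =>
    induction t using tensorSq_induction with
    | add t t' ht ht' => simp only [map_add, ht, ht']
    | smul_tmul w c d =>
      simp only [map_smulₛₗ, LinearMap.smul_apply, smul_eq_mul, mapSq_tmul, hΦ _ _ _ _, word,
        LinearMap.inl_apply, Complex.ofReal_zero, RingHom.id_apply]
      ring

/-- The equations in `IsExtensionData` are exactly what this comparison with `c⊗d` needs, for `c`,
`d` in `V` or equal to `Y`. -/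
theorem incl_sub_left_mem (hΦ : S.IsWordForm F g k m D Φ) (hE : S.IsExtensionData y e F g k m) :
    incl y - tmul (S.one, 0) (0, 1) ∈ LinearMap.ker Φ := by
  rw [LinearMap.mem_ker]
  refine linearMap_ext fun c d => ?_
  rw [map_sub, LinearMap.sub_apply, hΦ.apply_incl_tmul hE, hΦ, hE.J_eq, hE.contr_F, hE.contr_F,
    hE.contr_g]
  simp [word, hE.cubic.one_right hE.J_eq, hE.k_one, hE.g_symm c.1]
  ring

theorem incl_sub_right_mem (hΦ : S.IsWordForm F g k m D Φ) (hE : S.IsExtensionData y e F g k m) :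
    incl y - tmul (0, 1) (S.one, 0) ∈ LinearMap.ker Φ := by
  rw [LinearMap.mem_ker]
  refine linearMap_ext fun c d => ?_
  rw [map_sub, LinearMap.sub_apply, hΦ.apply_incl_tmul hE, hΦ, hE.J_eq, hE.contr_F, hE.contr_F,
    hE.contr_g]
  simp [word, hE.cubic.one_left, hE.k_one]
  ring

/-- Modulo the kernel of the form, every element is the sum of one of `(V ⊗ V) ⊗ ℂ` and of
multiples of `Y` by vectors orthogonal to `1`. -/
theorem exists_decomposition (hΦ : S.IsWordForm F g k m D Φ) (hE : S.IsExtensionData y e F g k m)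
    (s : TensorSq (V × ℝ)) :
    ∃ (t : TensorSq V) (a a' b b' : V) (z : ℂ), S.ip S.one a = 0 ∧ S.ip S.one a' = 0 ∧
      S.ip S.one b = 0 ∧ S.ip S.one b' = 0 ∧
      s - (incl t + (tmul (a, 0) (0, 1) + Complex.I • tmul (a', 0) (0, 1)
        + (tmul (0, 1) (b, 0) + Complex.I • tmul (0, 1) (b', 0)) + z • tmul (0, 1) (0, 1)))
        ∈ LinearMap.ker Φ := by
  induction s using tensorSq_induction with
  | add s s' hs hs' =>
    obtain ⟨t, a, a', b, b', z, h1, h2, h3, h4, h⟩ := hs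
    obtain ⟨u, c, c', d, d', w, k1, k2, k3, k4, k⟩ := hs'
    refine ⟨t + u, a + c, a' + c', b + d, b' + d', z + w, by simp [h1, k1], by simp [h2, k2],
      by simp [h3, k3], by simp [h4, k4], ?_⟩
    convert add_mem h k using 1
    have e1 : ∀ v w : V, ((v + w, 0) : V × ℝ) = (v, 0) + (w, 0) := fun v w => by simp
    simp only [e1, tmul_add_left, tmul_add_right, map_add, smul_add, add_smul]
    abel
  | smul_tmul z v w =>
    obtain ⟨a, α⟩ := v
    obtain ⟨b, β⟩ := w
    set ε := S.ip S.one with hε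
    have h0 : ∀ (r : ℝ) c, ε (r • (c - ε c • S.one)) = 0 := fun r c => by
      simp [hε, S.ip_one_one]
    -- The `1` components of `a` in `a⊗Y` and of `b` in `Y⊗b` are traded for multiples of `y`; the
    -- centred remainders are real vectors, so `z` is split into real and imaginary parts.
    refine ⟨z • tmul a b + (z * β * ε a) • y + (z * α * ε b) • y,
      (z.re * β) • (a - ε a • S.one), (z.im * β) • (a - ε a • S.one),
      (z.re * α) • (b - ε b • S.one), (z.im * α) • (b - ε b • S.one), z * α * β,
      h0 _ _, h0 _ _, h0 _ _, h0 _ _, ?_⟩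
    have k1 := Submodule.smul_mem _ (-(z * β * ε a)) (hΦ.incl_sub_left_mem hE)
    have k2 := Submodule.smul_mem _ (-(z * α * ε b)) (hΦ.incl_sub_right_mem hE)
    convert add_mem k1 k2 using 1
    have e1 : ((a, α) : V × ℝ) = (a, 0) + α • (0, 1) := by simp
    have e2 : ((b, β) : V × ℝ) = (b, 0) + β • (0, 1) := by simp
    have e3 : ∀ (r : ℝ) (v : V) (q : ℝ),
        ((r • (v - q • S.one), 0) : V × ℝ) = r • ((v, 0) - q • (S.one, 0)) := by
      intro r v q
      simp
    have hz : z = z.re + z.im * Complex.I := (Complex.re_add_im z).symm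
    rw [e1, e2, e3, e3, e3, e3]
    simp only [tmul_add_left, tmul_add_right, tmul_smul_left, tmul_smul_right, tmul_sub_left,
      tmul_sub_right, map_add, map_smul, mapSq_tmul, LinearMap.inl_apply, Complex.ofReal_mul]
    generalize tmul ((a, 0) : V × ℝ) (b, 0) = T₁
    generalize tmul ((a, 0) : V × ℝ) (0, 1) = T₂
    generalize tmul ((0, 1) : V × ℝ) (b, 0) = T₃
    generalize tmul ((0, 1) : V × ℝ) (0, 1) = T₄
    generalize tmul ((S.one, 0) : V × ℝ) (0, 1) = T₅
    generalize tmul ((0, 1) : V × ℝ) (S.one, 0) = T₆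
    rw [hz]
    simp only [Complex.add_re, Complex.add_im, Complex.ofReal_re, Complex.ofReal_im,
      Complex.mul_re, Complex.mul_im, Complex.I_re, Complex.I_im, mul_zero, mul_one, sub_zero,
      add_zero, zero_add]
    module

end IsWordForm

end CyclicStructure

/-! ### Positivity and construction of the extension -/

namespace CyclicStructure

variable {V : Type*} [AddCommGroup V] [Module ℝ V] {S : CyclicStructure V} {y : TensorSq V} {e : V}
  {F : V →ₗ[ℝ] V →ₗ[ℝ] V →ₗ[ℝ] ℂ} {g k : V →ₗ[ℝ] V →ₗ[ℝ] ℝ} {m : V →ₗ[ℝ] ℝ} {D : ℝ}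
  {Φ : SesqForm (V × ℝ)}

theorem exists_uniform_bound [FiniteDimensional ℝ V] {ι : Type*} [Fintype ι]
    {x : Module.Basis ι ℝ V} (hx : S.IsOrthonormal x)
    (hF : ∀ c s, S.form s s = 0 → contr (F c) s = 0) :
    ∃ K : ℝ, 0 ≤ K ∧ ∀ c s, ‖contr (F c) s‖ ^ 2 ≤ K * S.ip c c * (S.form s s).re := by
  choose K hK0 hK using fun i => S.form_hermitianPositive.exists_bound _ (hF (x i))
  refine ⟨∑ i, K i, Finset.sum_nonneg fun i _ => hK0 i, fun c s => ?_⟩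
  have h1 : contr (F c) s = ∑ i, (S.ip (x i) c : ℂ) * contr (F (x i)) s := by
    let L : V →ₗ[ℝ] ℂ :=
      { toFun := fun c => contr (F c) s
        map_add' := fun c c' => by simp [contr_add]
        map_smul' := fun r c => by simp [contr_smul] }
    have : L c = L (∑ i, x.repr c i • x i) := by rw [x.sum_repr]
    rw [map_sum] at this
    simpa [L, hx.repr_eq, contr_smul] using this
  have h2 : ‖contr (F c) s‖ ≤ ∑ i, |S.ip (x i) c| * ‖contr (F (x i)) s‖ := by
    rw [h1]
    refine (norm_sum_le _ _).trans_eq (Finset.sum_congr rfl fun i _ => ?_)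
    rw [norm_mul, Complex.norm_real, Real.norm_eq_abs]
  have h3 : ∑ i, |S.ip (x i) c| ^ 2 = S.ip c c := by
    rw [← hx.sum_ip_mul_ip c c]
    exact Finset.sum_congr rfl fun i _ => by rw [sq_abs, sq]
  calc ‖contr (F c) s‖ ^ 2 ≤ (∑ i, |S.ip (x i) c| * ‖contr (F (x i)) s‖) ^ 2 := by gcongr
    _ ≤ (∑ i, |S.ip (x i) c| ^ 2) * ∑ i, ‖contr (F (x i)) s‖ ^ 2 :=
      Finset.sum_mul_sq_le_sq_mul_sq _ _ _
    _ ≤ S.ip c c * ∑ i, K i * (S.form s s).re := by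
      rw [h3]
      have : 0 ≤ S.ip c c := by
        rw [← h3]; positivity
      gcongr with i
      exact hK i s
    _ = _ := by rw [← Finset.sum_mul]; ring

/-- AM-GM with weights suited to five cross terms, each counted twice: together they cost `10/12` of
`b`, while each `A` costs `6A`. This is the source of the constants `6 * K` and `6 * M`. -/
theorem abs_re_le_of_sq_le {w : ℂ} {A b : ℝ} (hA : 0 ≤ A) (hb : 0 ≤ b) (h : ‖w‖ ^ 2 ≤ A * b) :
    |w.re| ≤ 3 * A + b / 12 := by
  have h1 := Complex.abs_re_le_norm w
  have h2 : |w.re| ^ 2 ≤ (3 * A + b / 12) ^ 2 := by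
    calc |w.re| ^ 2 ≤ ‖w‖ ^ 2 := by gcongr
      _ ≤ A * b := h
      _ ≤ _ := by nlinarith [sq_nonneg (3 * A - b / 12)]
  exact le_of_sq_le_sq h2 (by positivity)

/-- Modulo the kernel, the part of `s` involving `Y` has square norm `6K` times the norms of the
centred vectors plus `6M|z|²`, as `k` and `m` vanish there. This absorbs the cross terms with `t` by
Young's inequality. -/
theorem IsWordForm.nonneg (hΦ : S.IsWordForm F g k m D Φ) (hE : S.IsExtensionData y e F g k m)
    {K M : ℝ} (hK : 0 ≤ K) (hM : 0 ≤ M) (hD : D = 6 * M)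
    (hFK : ∀ c s, ‖contr (F c) s‖ ^ 2 ≤ K * S.ip c c * (S.form s s).re)
    (hgM : ∀ s, ‖contr (toComplexForm g) s‖ ^ 2 ≤ M * (S.form s s).re)
    (hg : ∀ a b, S.ip S.one a = 0 → S.ip S.one b = 0 → g a b = 6 * K * S.ip a b)
    (hk : ∀ a b, S.ip S.one a = 0 → S.ip S.one b = 0 → k a b = 0)
    (hm : ∀ a, S.ip S.one a = 0 → m a = 0) (s : TensorSq (V × ℝ)) : 0 ≤ (Φ s s).re := by
  obtain ⟨t, a, a', b, b', z, ha, ha', hb, hb', hs⟩ := hΦ.exists_decomposition hE s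
  set v := tmul ((a, 0) : V × ℝ) (0, 1) + Complex.I • tmul (a', 0) (0, 1)
        + (tmul (0, 1) (b, 0) + Complex.I • tmul (0, 1) (b', 0)) + z • tmul (0, 1) (0, 1) with hv
  set n := s - (incl t + v) with hn
  rw [LinearMap.mem_ker] at hs
  have hsn : s = n + (incl t + v) := by rw [hn]; abel
  have h1 : Φ s s = Φ (incl t + v) (incl t + v) := by
    have hl : ∀ u, Φ n u = 0 := fun u => by rw [hs]; rfl
    have hr : ∀ u, Φ u n = 0 := fun u => by rw [hΦ.hermitian hE, hl, map_zero]
    rw [hsn]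
    simp only [map_add, LinearMap.add_apply, hl, hr, zero_add]
  have h2 : (Φ (incl t + v) (incl t + v)).re
      = (S.form t t).re + 2 * (Φ (incl t) v).re + (Φ v v).re := by
    simp only [map_add, LinearMap.add_apply, hΦ.apply_incl_incl, Complex.add_re]
    rw [hΦ.hermitian hE v (incl t), Complex.conj_re]
    ring
  have h3 : (Φ v v).re = 6 * K * (S.ip a a + S.ip a' a' + S.ip b b + S.ip b' b')
      + D * Complex.normSq z := by
    have hz : z * conj z = Complex.normSq z := Complex.mul_conj z
    have : Φ v v = 6 * K * (S.ip a a + S.ip a' a' + S.ip b b + S.ip b' b')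
        + D * Complex.normSq z := by
      simp only [hv, map_add, map_smulₛₗ, LinearMap.add_apply, LinearMap.smul_apply, smul_eq_mul,
        hΦ _ _ _ _, word, RingHom.id_apply, Complex.conj_I]
      simp only [map_zero, LinearMap.zero_apply, tmul_zero_left, tmul_zero_right,
        Complex.ofReal_zero, Complex.ofReal_one, mul_zero, zero_mul, add_zero, zero_add, one_mul,
        mul_one, hm _ ha, hm _ ha', hm _ hb, hm _ hb', hk _ _ ha hb, hk _ _ ha hb', hk _ _ ha' hb,
        hk _ _ ha' hb', hk _ _ hb ha, hk _ _ hb' ha, hk _ _ hb ha', hk _ _ hb' ha', hg _ _ ha ha,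
        hg _ _ ha ha', hg _ _ ha' ha, hg _ _ ha' ha', hg _ _ hb hb, hg _ _ hb hb', hg _ _ hb' hb,
        hg _ _ hb' hb']
      rw [S.ip_symm a' a, S.ip_symm b' b]
      push_cast
      linear_combination D * hz - 6 * K * (S.ip a' a' + S.ip b' b') * Complex.I_sq
    rw [this]
    norm_cast
  have h4 : Φ (incl t) v = contr (F a) t + -Complex.I * contr (F a') t
      + (conj (contr (F b) (J t)) + -Complex.I * conj (contr (F b') (J t)))
      + conj z * contr (toComplexForm g) t := by
    simp only [hv, map_add, map_smulₛₗ, smul_eq_mul, hΦ.apply_incl_tmul hE, Complex.conj_I]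
    simp
  have ht := S.form_hermitianPositive.nonneg t
  have hJt : (S.form (J t) (J t)).re = (S.form t t).re := by rw [S.form_J, Complex.conj_re]
  have ipn : ∀ c, 0 ≤ S.ip c c := fun c => by
    rcases eq_or_ne c 0 with rfl | hc
    · simp
    · exact (S.ip_pos c hc).le
  have b1 := abs_re_le_of_sq_le (w := contr (F a) t) (mul_nonneg hK (ipn a)) ht (hFK a t)
  have b2 := abs_re_le_of_sq_le (w := -Complex.I * contr (F a') t) (mul_nonneg hK (ipn a')) ht
    (by simpa using hFK a' t)
  have b3 := abs_re_le_of_sq_le (w := conj (contr (F b) (J t))) (mul_nonneg hK (ipn b)) ht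
    (by simpa [hJt] using hFK b (J t))
  have b4 := abs_re_le_of_sq_le (w := -Complex.I * conj (contr (F b') (J t)))
    (mul_nonneg hK (ipn b')) ht (by simpa [hJt] using hFK b' (J t))
  have b5 := abs_re_le_of_sq_le (w := conj z * contr (toComplexForm g) t)
    (mul_nonneg hM (Complex.normSq_nonneg z)) ht (by
      rw [norm_mul, mul_pow, RCLike.norm_conj, ← Complex.normSq_eq_norm_sq]
      nlinarith [mul_le_mul_of_nonneg_left (hgM t) (Complex.normSq_nonneg z)])
  rw [h1, h2, h3, h4, hD]
  simp only [Complex.add_re]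
  rw [abs_le] at b1 b2 b3 b4 b5
  linarith [b1.1, b2.1, b3.1, b4.1, b5.1]

theorem IsGeneric.contr_eq_zero (hG : S.IsGeneric y e) {β : V →ₗ[ℝ] V →ₗ[ℝ] ℂ}
    (hβ : β e S.one = β S.one e) (s : TensorSq V) (hs : S.form s s = 0) : contr β s = 0 := by
  obtain ⟨z, rfl⟩ := hG.null s hs
  simp [commOne, hβ]

/-- In the generic situation `y` can be adjoined to `V`. -/
theorem IsGeneric.exists_extension [FiniteDimensional ℝ V] {ι : Type*} [Fintype ι]
    {x : Module.Basis ι ℝ V} (hx : S.IsOrthonormal x) (hG : S.IsGeneric y e) :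
    ∃ U : CyclicStructure (V × ℝ), S.IsExtension S.form U ∧
      U.Same (mapSq (LinearMap.inl ℝ V ℝ) y) (tmul U.one (0, 1)) ∧
      U.Same (mapSq (LinearMap.inl ℝ V ℝ) y) (tmul (0, 1) U.one) := by
  obtain ⟨F, hF, hreal⟩ := hG.exists_real_isCubic
  obtain ⟨K, hK, hFK⟩ := exists_uniform_bound (F := F) hx fun c s hs =>
    hG.contr_eq_zero (hF.one_mid c).symm s hs
  set ε := S.ip S.one with hε
  have hε1 : ε S.one = 1 := S.ip_one_one
  let q : V →ₗ[ℝ] ℝ :=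
    { toFun := fun c => (contr (F c) y).re
      map_add' := fun c c' => by simp [contr_add]
      map_smul' := fun r c => by simp [contr_smul] }
  have hq : ∀ c, contr (F c) y = q c := fun c => (Complex.conj_eq_iff_re.1 (hreal c)).symm
  -- The symmetric form with `G(1,·) = q` that is `C` times the inner product on the complement of
  -- `1`; `C = 6K` gives `g` and `C = 0` gives `k`.
  let G : ℝ → V →ₗ[ℝ] V →ₗ[ℝ] ℝ := fun C => LinearMap.mk₂ ℝ
    (fun a b => C * (S.ip a b - ε a * ε b) + ε a * q b + ε b * q a - ε a * ε b * q S.one)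
    (by intros; simp only [map_add, LinearMap.add_apply]; ring)
    (by intros; simp only [map_smul, LinearMap.smul_apply, smul_eq_mul]; ring)
    (by intros; simp only [map_add]; ring)
    (by intros; simp only [map_smul, smul_eq_mul]; ring)
  have hGa : ∀ C a b, G C a b
      = C * (S.ip a b - ε a * ε b) + ε a * q b + ε b * q a - ε a * ε b * q S.one :=
    fun C a b => rfl
  have hG1 : ∀ C b, G C S.one b = q b := fun C b => by
    rw [hGa, hε1, ← hε]; ring
  have hGs : ∀ C a b, G C a b = G C b a := fun C a b => by
    rw [hGa, hGa, S.ip_symm a b]; ring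
  have hgy : contr (toComplexForm (G (6 * K))) y
      = ((contr (toComplexForm (G (6 * K))) y).re : ℂ) := by
    have := contr_J (β := toComplexForm (G (6 * K))) (γ := toComplexForm (G (6 * K)))
      (fun a b => by simp [hGs _ a b]) y
    rw [hG.J_eq] at this
    exact (Complex.conj_eq_iff_re.1 this.symm).symm
  let m : V →ₗ[ℝ] ℝ := (contr (toComplexForm (G (6 * K))) y).re • ε
  have hE : S.IsExtensionData y e F (G (6 * K)) (G 0) m :=
    { J_eq := hG.J_eq
      cubic := hF
      g_symm := hGs _
      k_symm := hGs _
      contr_F := fun c => by rw [hq, hG1]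
      k_one := fun c => by rw [hG1, hG1]
      contr_g := by rw [hgy]; simp [m, hε1] }
  -- `M` bounds the contraction with `g`, hence depends on `K`; `D = 6M` is still free at this
  -- stage.
  obtain ⟨M, hM, hgM⟩ := S.form_hermitianPositive.exists_bound
    (contr (toComplexForm (G (6 * K)))) (hG.contr_eq_zero (by simp [hGs _ e]))
  obtain ⟨Φ, hΦ⟩ := S.exists_isWordForm F (G (6 * K)) (G 0) m (6 * M)
  have hpos : IsHermitianPositive Φ :=
    { hermitian := hΦ.hermitian hE
      nonneg := hΦ.nonneg hE hK hM rfl hFK hgM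
        (fun a b ha hb => by rw [hGa, show ε a = 0 from ha, show ε b = 0 from hb]; ring)
        (fun a b ha hb => by rw [hGa, show ε a = 0 from ha, show ε b = 0 from hb]; ring)
        (fun a ha => by simp [m, show ε a = 0 from ha]) }
  have hy1 : ∀ a, S.form y (tmul a S.one) = ((S.form y (tmul a S.one)).re : ℂ) := fun a => by
    rw [eq_comm, ← Complex.conj_eq_iff_re, conj_form_tmul hG.J_eq, hG.unit]
  let ρ : V →ₗ[ℝ] ℝ :=
    { toFun := fun a => (S.form y (tmul a S.one)).re
      map_add' := fun a b => by simp [tmul_add_left]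
      map_smul' := fun r a => by simp [tmul_smul_left, -Complex.coe_smul] }
  let N : ℝ := (S.form y y).re
  have hyy : S.form y y = N := S.form_hermitianPositive.self_eq y
  have hρ : ∀ a, S.form y (tmul a S.one) = ρ a := hy1
  have hρ' : ∀ a, S.form y (tmul S.one a) = ρ a := fun a => by rw [← hG.unit, hρ]
  have hq1 : (q S.one : ℂ) = N := by rw [← hq, hF.contr_one hG.J_eq, hyy]
  -- The inner product is forced: `(a, α)` has the square norm of `a⊗1 + αy`. It is definite because
  -- `y` does not agree with any `v⊗1`.
  let ip : V × ℝ →ₗ[ℝ] V × ℝ →ₗ[ℝ] ℝ := LinearMap.mk₂ ℝ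
    (fun v w => S.ip v.1 w.1 + v.2 * ρ w.1 + w.2 * ρ v.1 + v.2 * w.2 * N)
    (by intros; simp only [Prod.fst_add, Prod.snd_add, map_add, LinearMap.add_apply]; ring)
    (by
      intros
      simp only [Prod.smul_fst, Prod.smul_snd, map_smul, LinearMap.smul_apply, smul_eq_mul]; ring)
    (by intros; simp only [Prod.fst_add, Prod.snd_add, map_add]; ring)
    (by intros; simp only [Prod.smul_fst, Prod.smul_snd, map_smul, smul_eq_mul]; ring)
  have hip : ∀ v w, ip v w = S.ip v.1 w.1 + v.2 * ρ w.1 + w.2 * ρ v.1 + v.2 * w.2 * N :=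
    fun v w => rfl
  let U : CyclicStructure (V × ℝ) :=
    { ip := ip
      ip_symm := fun v w => by rw [hip, hip, S.ip_symm]; ring
      ip_pos := by
        rintro ⟨a, α⟩ hne
        rw [hip]
        simp only
        by_cases hα : α = 0
        · subst hα
          have : a ≠ 0 := fun h => hne (by simp [h])
          simpa using S.ip_pos a this
        · have h1 := S.form_hermitianPositive.nonneg (y - tmul (-(α⁻¹ • a)) S.one)
          have h2 := hG.not_mem (-(α⁻¹ • a))
          rw [S.form_hermitianPositive.self_eq] at h2
          have h3 : 0 < (S.form (y - tmul (-(α⁻¹ • a)) S.one)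
              (y - tmul (-(α⁻¹ • a)) S.one)).re :=
            lt_of_le_of_ne h1 fun h => h2 (by rw [← h]; simp)
          have h4 : S.form (tmul a S.one) y = ρ a := by
            rw [S.form_hermitianPositive.hermitian, hρ, Complex.conj_ofReal]
          have h5 : S.form (y - tmul (-(α⁻¹ • a)) S.one) (y - tmul (-(α⁻¹ • a)) S.one)
              = ((N + 2 * α⁻¹ * ρ a + α⁻¹ * α⁻¹ * S.ip a a : ℝ) : ℂ) := by
            rw [← neg_smul, tmul_smul_left]
            simp only [map_sub, map_smulₛₗ, LinearMap.sub_apply, LinearMap.smul_apply,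
              smul_eq_mul, hρ, h4, hyy, S.isometric_right, RingHom.id_apply, Complex.conj_ofReal]
            push_cast
            ring
          rw [h5, Complex.ofReal_re] at h3
          have h6 : S.ip a a + α * ρ a + α * ρ a + α * α * N
              = α ^ 2 * (N + 2 * α⁻¹ * ρ a + α⁻¹ * α⁻¹ * S.ip a a) := by
            field_simp
            ring
          rw [h6]
          positivity
      one := (S.one, 0)
      ip_one_one := by rw [hip]; simp [S.ip_one_one]
      form := Φ
      form_hermitianPositive := hpos
      isometric_right := fun v => by
        rw [hΦ, hip]
        simp only [word, Complex.ofReal_zero, S.isometric_right, hF.one_left,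
          hF.one_right hG.J_eq, hρ, hρ', hG1, hq1]
        push_cast
        ring
      isometric_left := fun v => by
        rw [hΦ, hip]
        simp only [word, Complex.ofReal_zero, S.isometric_left, hF.one_left,
          hF.one_right hG.J_eq, hρ, hρ', hG1, hq1]
        push_cast
        ring
      cyclic := fun a b c d => by rw [hΦ, hΦ, word_cyclic hE]
      selfAdjoint := fun a b c d => by
        rw [hΦ, hΦ, conj_word hE, word_cyclic hE a b d c, word_cyclic hE c a b d] }
  refine ⟨U, ⟨rfl, fun v w => ?_, hΦ.apply_incl_incl⟩, ?_, ?_⟩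
  · change ip _ _ = _
    rw [hip]
    simp
  · have := hΦ.incl_sub_left_mem hE
    rw [LinearMap.mem_ker] at this
    change Φ (incl y - tmul (S.one, 0) (0, 1)) _ = 0
    rw [this]
    rfl
  · have := hΦ.incl_sub_right_mem hE
    rw [LinearMap.mem_ker] at this
    change Φ (incl y - tmul (0, 1) (S.one, 0)) _ = 0
    rw [this]
    rfl

theorem Same.trans_null {s s' t : TensorSq V} (h : S.Same s' t)
    (hs : S.form (s - s') (s - s') = 0) : S.Same s t := by
  have := form_add_null hs (s' - t)
  rw [h] at this
  rw [Same, ← this]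
  congr 2 <;> abel_nf

end CyclicStructure

end CyclicSpace

end

/-! ### The theorem -/

open CyclicSpace in
theorem proposition3p2 {V : Type*} [AddCommGroup V] [Module ℝ V] [FiniteDimensional ℝ V]
    (S : CyclicStructure V)
    {ι : Type*} [Fintype ι] (x : Module.Basis ι ℝ V) (hx : S.IsOrthonormal x)
    (y : TensorSq V) (hy_sa : J y = y) (hy_norm : S.form y y = 1) (hy_nt : S.NonTrivial y)
    (hy_unit : ∀ v : V, S.form y (tmul v S.one) = S.form y (tmul S.one v))
    (ε : ℝ) (hε : 0 < ε) :
    ∃ B : SesqForm V, S.IsPerturbation x ε B ∧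
      ∃ U : CyclicStructure (V × ℝ), S.IsExtension B U ∧
        U.Same (mapSq (LinearMap.inl ℝ V ℝ) y) (tmul U.one (0, 1)) ∧
        U.Same (mapSq (LinearMap.inl ℝ V ℝ) y) (tmul (0, 1) U.one) := by
  obtain ⟨T, hip, hone, hclose, y', e, hyy', hG⟩ :=
    CyclicStructure.exists_isGeneric x hx hy_sa hy_nt.1 hy_unit hε
  have hxT : T.IsOrthonormal x := by rwa [CyclicStructure.IsOrthonormal, hip]
  obtain ⟨U, ⟨h1, h2, h3⟩, hl, hr⟩ := hG.exists_extension hxT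
  -- The extension adjoins `y'`, which differs from `y` by a null vector of `T`, and this remains
  -- null in `U`.
  have hnull : U.form (mapSq (LinearMap.inl ℝ V ℝ) y - mapSq (LinearMap.inl ℝ V ℝ) y')
      (mapSq (LinearMap.inl ℝ V ℝ) y - mapSq (LinearMap.inl ℝ V ℝ) y') = 0 := by
    rw [← map_sub, h3, hyy']
  exact ⟨T.form, ⟨T.form_hermitianPositive, hclose⟩, U, ⟨hone ▸ h1, hip ▸ h2, h3⟩,
    hl.trans_null hnull, hr.trans_null hnull⟩
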